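/- Fix real numbers $\varepsilon,\omega>0$ (periodicity and frequency) and an integer $K\ge 1$, and put $H=\varepsilon K$, $\Omega=\mathbb R\times(0,H)$, $Y_\varepsilon=(0,\varepsilon)^2$. Let $R,L\ge 1$ be integers and $\delta>0$. For an integer $S \geq 1$ put $\Omega_S=(-\varepsilon S,\varepsilon S)\times(0,H)$, and let $W^+=(\varepsilon R,\varepsilon(R+L))\times(0,H)$, $W^-=(-\varepsilon(R+L),-\varepsilon R)\times(0,H)$, $W=(0,\varepsilon L)\times(0,H)$. All $H^1$ spaces on these rectangles consist of complex-valued functions that are periodic in the vertical variable $x_2$ (i.e. $H$-periodic in $x_2$ and weakly differentiable across $x_2\in H\mathbb Z$); $H^1_\sharp(Y_\varepsilon)$ denotes the complex-valued $Y_\varepsilon$-periodic $H^1$ functions. **Coefficients.** Let $a\in L^\infty(\Omega;\mathbb R)$ satisfy $0<a_0\le a\le a_1$ almost everywhere, and let $a=a_+$ for $x_1>\varepsilon R/2$ and $a=a_-$ for $x_1<-\varepsilon R/2$ with $Y_\varepsilon$-periodic functions $a_\pm:\mathbb R^2\to\mathbb R$. **Bloch waves.** Let $Q_N=\{0,\frac1N,\dots,\frac{N-1}N\}$.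 For $j\in Q_L\times Q_K$ let $(\Psi^\pm_{j,m})_{m\ge 0}\subset H^1_\sharp(Y_\varepsilon)$ be an orthogonal family of (weak) eigenfunctions of $-(\nabla+2\pi i j/\varepsilon)\cdot\big(a_\pm(\nabla+2\pi i j/\varepsilon)\,\cdot\,\big)$, with nondecreasing eigenvalues and normalized by $|Y_\varepsilon|^{-1}\int_{Y_\varepsilon}|\Psi^\pm_{j,m}|^2=1$. For $\lambda=(j,m)$ put $$U^\pm_\lambda(x)=\Psi^\pm_{j,m}(x)\,e^{2\pi i j\cdot x/\varepsilon},\qquad P^\pm_\lambda=\operatorname{Im}\frac1{|Y_\varepsilon|}\int_{Y_\varepsilon}\overline{U^\pm_\lambda}\;a_\pm\,\partial_1U^\pm_\lambda\,dx .$$ Let $I^\pm$ be sets of indices $\lambda=(j,m)$ with $j\in Q_L\times Q_K$, $m\in\mathbb N_0$, and let $X^\pm=\operatorname{span}\{U^\pm_\lambda:\lambda\in I^\pm\}$. Assume, with constants $c_0,C_0>0$: * (A1) $\pm P^\pm_\lambda\ge c_0$ for every $\lambda\in I^\pm$; * (A2) any two distinct indices $(j,m),(\tilde j,\tilde m)\in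 I^+$ satisfy $j\ne\tilde j$, and likewise in $I^-$; * (A3) $\|w\|^2_{H^1(W)}\le C_0\|w\|^2_{L^2(W)}$ for every $w\in X^\pm$. **Problem (P).** Let $V$ be the set of all $u\in H^1(\Omega_{R+L})$ such that, as functions of $x\in W$, $u(\varepsilon R+x_1,x_2)$ belongs to $X^+$ and $u(-\varepsilon(R+L)+x_1,x_2)$ belongs to $X^-$. Let $\vartheta(x)=1$ for $|x_1|\le\varepsilon R$, $\vartheta(x)=0$ for $|x_1|\ge\varepsilon(R+L)$, and $\vartheta(x)=(\varepsilon(R+L)-|x_1|)/(\varepsilon L)$ otherwise. Let $f\in L^2(\Omega)$ be supported in $\Omega_R$. For $u,v\in V$ put $$\beta(u,v)=\int_{\Omega_{R+L}}a\,\nabla\bar u\cdot\nabla v\,\vartheta-\int_{\Omega_{R+L}}(1-i\delta\mathbf 1_{\Omega_R})\,\omega^2\,\bar u\,v\,\vartheta-\frac1{\varepsilon L}\int_{W^+}a\,\partial_1\bar u\,v+\frac1{\varepsilon L}\int_{W^-}a\,\partial_1\bar u\,v .$$ A solution of (P) is a function $u\in V$ with $\beta(u,v)=\int_{\Omega_R}\bar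 f\,v$ for all $v\in V$. **Theorem.** Problem (P) has a unique solution $u$, and $$\|u\|_{H^1(\Omega_{R+L})}\le C\,\|f\|_{L^2(\Omega_R)}$$ with a constant $C$ that depends only on $R,L,a_0,a_1,\delta,c_0,C_0$ and on the fixed parameters $\varepsilon,\omega,K$. -/

import Mathlib

open MeasureTheory Set
open scoped ComplexConjugate

noncomputable section

namespace Waveguide

/-! ### Sobolev spaces with periodicity conditions, through weak derivatives -/

/-- Test functions: complex-valued, smooth, with compact support in the open set `D`. -/
structure IsTest (D : Set (ℝ × ℝ)) (φ : ℝ × ℝ → ℂ) : Prop where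
  smooth : ContDiff ℝ (⊤ : ℕ∞) φ
  compact : HasCompactSupport φ
  subset : tsupport φ ⊆ D

/-- `(g₁, g₂)` is the weak gradient of `u` in the open set `D`. -/
def HasWeakGrad (D : Set (ℝ × ℝ)) (u g₁ g₂ : ℝ × ℝ → ℂ) : Prop :=
  ∀ φ : ℝ × ℝ → ℂ, IsTest D φ →
    (∫ x in D, u x * fderiv ℝ φ x (1, 0)) = -∫ x in D, g₁ x * φ x ∧
    (∫ x in D, u x * fderiv ℝ φ x (0, 1)) = -∫ x in D, g₂ x * φ x

/-- The open rectangle `(l, r) × (0, H)`. -/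
def rect (l r H : ℝ) : Set (ℝ × ℝ) := Ioo l r ×ˢ Ioo 0 H

/-- An element of `H¹((l, r) × (0, H)_♯; ℂ)`, together with its weak gradient `(d₁, d₂)`. Vertical
periodicity is imposed by asking that `u` is `H`-periodic in `x₂` and weakly differentiable across
the lines `x₂ ∈ H ℤ`, that is, on the whole strip `(l, r) × ℝ`. Elements are functions, not classes
of functions; two of them are the same element of the Sobolev space if their values agree almost
everywhere on `(l, r) × (0, H)`. -/
structure H1Strip (l r H : ℝ) where
  val : ℝ × ℝ → ℂ
  d₁ : ℝ × ℝ → ℂ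
  d₂ : ℝ × ℝ → ℂ
  periodic_val : Function.Periodic val ((0, H) : ℝ × ℝ)
  periodic_d₁ : Function.Periodic d₁ ((0, H) : ℝ × ℝ)
  periodic_d₂ : Function.Periodic d₂ ((0, H) : ℝ × ℝ)
  memLp_val : MemLp val 2 (volume.restrict (rect l r H))
  memLp_d₁ : MemLp d₁ 2 (volume.restrict (rect l r H))
  memLp_d₂ : MemLp d₂ 2 (volume.restrict (rect l r H))
  weakGrad : HasWeakGrad (Ioo l r ×ˢ univ) val d₁ d₂

/-- The squared `L²` norm of a function on a set. -/
def l2NormSq (D : Set (ℝ × ℝ)) (u : ℝ × ℝ → ℂ) : ℝ := ∫ x in D, ‖u x‖ ^ 2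

/-- The squared `H¹` norm on `(l, r) × (0, H)`. -/
def H1Strip.h1NormSq {l r H : ℝ} (u : H1Strip l r H) : ℝ :=
  l2NormSq (rect l r H) u.val + l2NormSq (rect l r H) u.d₁ + l2NormSq (rect l r H) u.d₂

/-- The periodicity cell `Y_ε = (0, ε)²`. -/
def cell (ε : ℝ) : Set (ℝ × ℝ) := rect 0 ε ε

/-- `u` is `Y_ε`-periodic, i.e. `ε`-periodic in both variables. -/
def CellPeriodic {α : Type*} (ε : ℝ) (u : ℝ × ℝ → α) : Prop :=
  Function.Periodic u ((ε, 0) : ℝ × ℝ) ∧ Function.Periodic u ((0, ε) : ℝ × ℝ)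

/-- An element of `H¹_♯(Y_ε; ℂ)`, extended periodically to the plane, with its weak gradient. -/
structure H1Cell (ε : ℝ) where
  val : ℝ × ℝ → ℂ
  d₁ : ℝ × ℝ → ℂ
  d₂ : ℝ × ℝ → ℂ
  periodic_val : CellPeriodic ε val
  periodic_d₁ : CellPeriodic ε d₁
  periodic_d₂ : CellPeriodic ε d₂
  memLp_val : MemLp val 2 (volume.restrict (cell ε))
  memLp_d₁ : MemLp d₁ 2 (volume.restrict (cell ε))
  memLp_d₂ : MemLp d₂ 2 (volume.restrict (cell ε))
  weakGrad : HasWeakGrad univ val d₁ d₂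

/-! ### Bloch waves -/

/-- The factor `2 π i t / ε`. -/
def shift (ε t : ℝ) : ℂ := 2 * Real.pi * Complex.I * t / ε

/-- First component of `(∇ + 2 π i j / ε) Ψ`. -/
def H1Cell.D₁ {ε : ℝ} (j : ℝ × ℝ) (Ψ : H1Cell ε) (x : ℝ × ℝ) : ℂ :=
  Ψ.d₁ x + shift ε j.1 * Ψ.val x

/-- Second component of `(∇ + 2 π i j / ε) Ψ`. -/
def H1Cell.D₂ {ε : ℝ} (j : ℝ × ℝ) (Ψ : H1Cell ε) (x : ℝ × ℝ) : ℂ :=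
  Ψ.d₂ x + shift ε j.2 * Ψ.val x

/-- `Ψ` solves `-(∇ + 2πij/ε) · (a (∇ + 2πij/ε) Ψ) = μ Ψ` weakly in `H¹_♯(Y_ε; ℂ)`. -/
def IsBlochEigen (ε : ℝ) (a : ℝ × ℝ → ℝ) (j : ℝ × ℝ) (μ : ℝ) (Ψ : H1Cell ε) : Prop :=
  ∀ Φ : H1Cell ε,
    (∫ x in cell ε, (a x : ℂ) * (Ψ.D₁ j x * conj (Φ.D₁ j x) + Ψ.D₂ j x * conj (Φ.D₂ j x)))
      = (μ : ℂ) * ∫ x in cell ε, Ψ.val x * conj (Φ.val x)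

/-- `(Ψ_m)_m` is a family of Bloch eigenfunctions for the wave vector `j`: eigenfunctions with
nondecreasing eigenvalues, orthogonal, and normalized by `⨍_{Y_ε} |Ψ_m|² = 1`. -/
def IsBlochFamily (ε : ℝ) (a : ℝ × ℝ → ℝ) (j : ℝ × ℝ) (Ψ : ℕ → H1Cell ε) : Prop :=
  (∃ μ : ℕ → ℝ, Monotone μ ∧ ∀ m, IsBlochEigen ε a j (μ m) (Ψ m)) ∧
  ∀ m n, (⨍ x in cell ε, conj ((Ψ m).val x) * (Ψ n).val x) = if m = n then 1 else 0

/-- Indices `λ = (j, m)` in `I_{L,K}`; the pair `(k₁, k₂)` stands for `j = (k₁/L, k₂/K)`. -/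
abbrev BlochIndex (L K : ℕ) : Type := (Fin L × Fin K) × ℕ

/-- The wave vector `j = (k₁/L, k₂/K)` in `Q_L × Q_K`. -/
def waveVector {L K : ℕ} (k : Fin L × Fin K) : ℝ × ℝ :=
  ((k.1 : ℕ) / (L : ℝ), (k.2 : ℕ) / (K : ℝ))

/-- The phase factor `e^{2 π i j · x / ε}`. -/
def phase (ε : ℝ) (j x : ℝ × ℝ) : ℂ := Complex.exp (shift ε (j.1 * x.1 + j.2 * x.2))

/-- The Bloch wave `U_λ(x) = Ψ_λ(x) e^{2 π i j · x / ε}`. -/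
def blochWave {ε : ℝ} {L K : ℕ} (Ψ : Fin L × Fin K → ℕ → H1Cell ε) (lam : BlochIndex L K)
    (x : ℝ × ℝ) : ℂ :=
  (Ψ lam.1 lam.2).val x * phase ε (waveVector lam.1) x

/-- The derivative `∂₁ U_λ = ((∂₁ + 2 π i j₁ / ε) Ψ_λ) e^{2 π i j · x / ε}`. -/
def blochWaveD₁ {ε : ℝ} {L K : ℕ} (Ψ : Fin L × Fin K → ℕ → H1Cell ε) (lam : BlochIndex L K)
    (x : ℝ × ℝ) : ℂ :=
  (Ψ lam.1 lam.2).D₁ (waveVector lam.1) x * phase ε (waveVector lam.1) x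

/-- The Poynting number `P_λ = Im ⨍_{Y_ε} conj(U_λ) e₁ · (a ∇U_λ)`. -/
def poynting {ε : ℝ} {L K : ℕ} (a : ℝ × ℝ → ℝ) (Ψ : Fin L × Fin K → ℕ → H1Cell ε)
    (lam : BlochIndex L K) : ℝ :=
  (⨍ x in cell ε, conj (blochWave Ψ lam x) * ((a x : ℂ) * blochWaveD₁ Ψ lam x)).im

/-- The space `X = span {U_λ | λ ∈ I}`. -/
def blochSpan {ε : ℝ} {L K : ℕ} (Ψ : Fin L × Fin K → ℕ → H1Cell ε) (I : Set (BlochIndex L K)) :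
    Submodule ℂ (ℝ × ℝ → ℂ) :=
  Submodule.span ℂ (blochWave Ψ '' I)

/-- The reference box `W = (0, εL) × (0, εK)`. -/
def box (ε : ℝ) (L K : ℕ) : Set (ℝ × ℝ) := rect 0 (ε * L) (ε * K)

/-- `u`, as a function on the box `W`, belongs to the function space `X`. -/
def InSpan (ε : ℝ) (L K : ℕ) (X : Submodule ℂ (ℝ × ℝ → ℂ)) (u : ℝ × ℝ → ℂ) : Prop :=
  ∃ w ∈ X, u =ᵐ[volume.restrict (box ε L K)] w

/-- The three conditions on an index set `I`, with constants `c₀`, `C₀`. The sign `s` is `1` for the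
right radiation box and `-1` for the left one. -/
structure IsAdmissible {ε : ℝ} {L K : ℕ} (s : ℝ) (a : ℝ × ℝ → ℝ)
    (Ψ : Fin L × Fin K → ℕ → H1Cell ε) (I : Set (BlochIndex L K)) (c₀ C₀ : ℝ) : Prop where
  /-- positive speed -/
  speed : ∀ lam ∈ I, c₀ ≤ s * poynting a Ψ lam
  /-- different indices have different wave vectors -/
  wave_ne : ∀ lam ∈ I, ∀ lam' ∈ I, lam ≠ lam' → lam.1 ≠ lam'.1
  /-- regularity (inverse estimate) on `W` -/
  inverse : ∀ w : H1Strip 0 (ε * L) (ε * K), InSpan ε L K (blochSpan Ψ I) w.val →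
    w.h1NormSq ≤ C₀ * l2NormSq (box ε L K) w.val

/-! ### The truncated domain and problem (P) -/

/-- The infinite strip `Ω = ℝ × (0, εK)`. -/
def strip (ε : ℝ) (K : ℕ) : Set (ℝ × ℝ) := univ ×ˢ Ioo 0 (ε * K)

/-- The truncated domain `Ω_S = (-εS, εS) × (0, εK)`. -/
def trunc (ε : ℝ) (K S : ℕ) : Set (ℝ × ℝ) := rect (-(ε * S)) (ε * S) (ε * K)

/-- The space `H¹(Ω_S)` of vertically periodic functions. -/
abbrev H1Trunc (ε : ℝ) (K S : ℕ) : Type := H1Strip (-(ε * S)) (ε * S) (ε * K)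

/-- The right radiation box `W⁺_{R,L}`. -/
def boxRight (ε : ℝ) (K R L : ℕ) : Set (ℝ × ℝ) := rect (ε * R) (ε * (R + L : ℕ)) (ε * K)

/-- The left radiation box `W⁻_{R,L}`. -/
def boxLeft (ε : ℝ) (K R L : ℕ) : Set (ℝ × ℝ) := rect (-(ε * (R + L : ℕ))) (-(ε * R)) (ε * K)

/-- The restriction `{u}⁺_{R,L}` to the right box, shifted to `W`. -/
def restrictRight (ε : ℝ) (R : ℕ) (u : ℝ × ℝ → ℂ) (x : ℝ × ℝ) : ℂ := u (ε * R + x.1, x.2)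

/-- The restriction `{u}⁻_{R,L}` to the left box, shifted to `W`. -/
def restrictLeft (ε : ℝ) (R L : ℕ) (u : ℝ × ℝ → ℂ) (x : ℝ × ℝ) : ℂ :=
  u (-(ε * (R + L : ℕ)) + x.1, x.2)

/-- The space `V`, as a predicate on `H¹(Ω_{R+L})`. -/
def MemV {ε : ℝ} {K R L : ℕ} (Xp Xm : Submodule ℂ (ℝ × ℝ → ℂ)) (u : H1Trunc ε K (R + L)) : Prop :=
  InSpan ε L K Xp (restrictRight ε R u.val) ∧ InSpan ε L K Xm (restrictLeft ε R L u.val)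

/-- The cut-off function `ϑ`. -/
def cutoff (ε : ℝ) (R L : ℕ) (ξ : ℝ) : ℝ :=
  if ε * (R + L : ℕ) ≤ |ξ| then 0
  else if |ξ| ≤ ε * R then 1
  else (ε * (R + L : ℕ) - |ξ|) / (ε * L)

/-- The sesquilinear form `β`, antilinear in the first argument. -/
def beta {ε : ℝ} {K R L : ℕ} (ω δ : ℝ) (a : ℝ × ℝ → ℝ) (u v : H1Trunc ε K (R + L)) : ℂ :=
  (∫ x in trunc ε K (R + L),
      (a x : ℂ) * (conj (u.d₁ x) * v.d₁ x + conj (u.d₂ x) * v.d₂ x) * (cutoff ε R L x.1 : ℂ))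
  - (∫ x in trunc ε K (R + L),
      (1 - Complex.I * δ * (trunc ε K R).indicator (fun _ => (1 : ℂ)) x) * (ω : ℂ) ^ 2
        * conj (u.val x) * v.val x * (cutoff ε R L x.1 : ℂ))
  - (1 / (ε * L : ℂ)) * (∫ x in boxRight ε K R L, (a x : ℂ) * conj (u.d₁ x) * v.val x)
  + (1 / (ε * L : ℂ)) * (∫ x in boxLeft ε K R L, (a x : ℂ) * conj (u.d₁ x) * v.val x)

/-- `u` solves problem (P): `u ∈ V` and `β(u, v) = ∫_{Ω_R} conj(f) v` for all `v ∈ V`. -/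
def IsSolution {ε : ℝ} {K R L : ℕ} (ω δ : ℝ) (a : ℝ × ℝ → ℝ) (Xp Xm : Submodule ℂ (ℝ × ℝ → ℂ))
    (f : ℝ × ℝ → ℂ) (u : H1Trunc ε K (R + L)) : Prop :=
  MemV Xp Xm u ∧ ∀ v : H1Trunc ε K (R + L), MemV Xp Xm v →
    beta ω δ a u v = ∫ x in trunc ε K R, conj (f x) * v.val x

/-- The coefficient `a ∈ L^∞(Ω; ℝ)`, with `a₀ ≤ a ≤ a₁`, coincides with the `Y_ε`-periodic `aP` for
`x₁ > εR/2` and with the `Y_ε`-periodic `aM` for `x₁ < -εR/2`. -/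
structure IsMedium (ε : ℝ) (K R : ℕ) (a₀ a₁ : ℝ) (a aP aM : ℝ × ℝ → ℝ) : Prop where
  measurable : AEStronglyMeasurable a (volume.restrict (strip ε K))
  lower : ∀ᵐ x ∂volume.restrict (strip ε K), a₀ ≤ a x
  upper : ∀ᵐ x ∂volume.restrict (strip ε K), a x ≤ a₁
  periodicP : CellPeriodic ε aP
  periodicM : CellPeriodic ε aM
  eqP : ∀ᵐ x ∂volume.restrict (strip ε K), ε * R / 2 < x.1 → a x = aP x
  eqM : ∀ᵐ x ∂volume.restrict (strip ε K), x.1 < -(ε * R / 2) → a x = aM x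

end Waveguide

end

open Waveguide

namespace Waveguide

/-! ### Tiling a rectangle by translates -/

/-! The proof is Lax–Milgram on `V`, with coercivity of a combination Re β(u,u) + M Im β(u,u).

The imaginary part controls the L² norm on the whole truncated domain. In Ω_R this is the absorption
term δω²‖u‖². In a radiation box the boundary term of β is an energy flux. There u is a finite
combination of Bloch waves with pairwise different wave vectors j ∈ Q_L × Q_K. Products
conj(U_λ)·U_μ and conj(U_λ)·a∂₁U_μ acquire root-of-unity factors under translation by ε, so for
different wave vectors their integrals over the L × K cells cancel by a geometric sum. Both the flux
and the squared L² norm are therefore diagonal in the coefficients, and (A1) bounds the flux, with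
the correct sign on each side, by c₀ times the squared L² norm (`flux_lower_bound`).

The real part controls the gradient in Ω_R, where ϑ = 1, up to the term -ω²‖u‖² and the real parts
of the flux integrals. In the boxes, where ϑ degenerates, the inverse estimate (A3) bounds the
gradient by the L² norm. All defects are thus multiples of the L² norm, and a large M absorbs them
(`beta_coercive`).

For the functional-analytic frame, H¹ functions are encoded as triples (u, ∂₁u, ∂₂u) in a Hilbert
sum of L² spaces. The weak gradient relation is an intersection of kernels of continuous
functionals, and the Bloch condition is the preimage of a finite-dimensional space, so `V` becomes a
closed subspace (`exists_closed_memV`). β and the source extend to bounded objects on all triples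
(`exists_beta_form`, `exists_source_functional`), and `lax_milgram` applies. -/

theorem map_add_right_restrict (v : ℝ × ℝ) {S T : Set (ℝ × ℝ)} (h : (fun x => x + v) ⁻¹' T = S) :
    (volume.restrict S).map (fun x => x + v) = volume.restrict T := by
  rw [← h]
  exact ((measurePreserving_add_right volume v).restrict_preimage_emb
    (measurableEmbedding_addRight v) T).map_eq

/-- Phrased for measures, so that integrability, L² membership and integrals all pass from one cell
to the tiled rectangle by the same identity. -/
theorem restrict_Ioo_prod_eq_sum (c h : ℝ) (hh : 0 < h) {B : Set ℝ} (hB : MeasurableSet B) (n : ℕ) :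
    (volume.restrict (Ioo c (c + n * h) ×ˢ B) : Measure (ℝ × ℝ)) =
      ∑ p ∈ Finset.range n,
        (volume.restrict (Ioo 0 h ×ˢ B)).map (fun x => x + ((c + p * h, 0) : ℝ × ℝ)) := by
  induction n with
  | zero => simp
  | succ n ih =>
    rw [Finset.sum_range_succ, ← ih]
    have hnh : 0 ≤ n * h := by positivity
    -- Open intervals leave out the common endpoints. Half-open ones tile exactly and differ from
    -- them by null sets.
    have e : (Ioo c (c + (n + 1 : ℕ) * h) ×ˢ B : Set (ℝ × ℝ)) =ᵐ[volume]
        ((Ioc c (c + n * h) ×ˢ B) ∪ (Ioc (c + n * h) (c + (n + 1 : ℕ) * h) ×ˢ B) : Set _) := by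
      rw [← union_prod, Ioc_union_Ioc_eq_Ioc (by linarith) (by push_cast; nlinarith)]
      exact Measure.set_prod_ae_eq Ioo_ae_eq_Ioc (Filter.EventuallyEq.refl _ _)
    rw [Measure.restrict_congr_set e, Measure.restrict_union _ (measurableSet_Ioc.prod hB)]
    · congr 1
      · exact Measure.restrict_congr_set
          (Measure.set_prod_ae_eq Ioo_ae_eq_Ioc.symm (Filter.EventuallyEq.refl _ _))
      · rw [map_add_right_restrict (T := Ioo (c + n * h) (c + (n + 1 : ℕ) * h) ×ˢ B)]
        · exact Measure.restrict_congr_set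
            (Measure.set_prod_ae_eq Ioo_ae_eq_Ioc.symm (Filter.EventuallyEq.refl _ _))
        · ext x
          simp only [mem_preimage, mem_prod, mem_Ioo, Prod.fst_add, Prod.snd_add, add_zero]
          push_cast
          constructor <;> rintro ⟨⟨h1, h2⟩, h3⟩ <;> refine ⟨⟨?_, ?_⟩, h3⟩ <;> linarith
    · exact Disjoint.set_prod_left (Ioc_disjoint_Ioc_of_le le_rfl) _ _

theorem restrict_prod_Ioo_eq_sum (c h : ℝ) (hh : 0 < h) {B : Set ℝ} (hB : MeasurableSet B) (n : ℕ) :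
    (volume.restrict (B ×ˢ Ioo c (c + n * h)) : Measure (ℝ × ℝ)) =
      ∑ p ∈ Finset.range n,
        (volume.restrict (B ×ˢ Ioo 0 h)).map (fun x => x + ((0, c + p * h) : ℝ × ℝ)) := by
  induction n with
  | zero => simp
  | succ n ih =>
    rw [Finset.sum_range_succ, ← ih]
    have hnh : 0 ≤ n * h := by positivity
    have e : (B ×ˢ Ioo c (c + (n + 1 : ℕ) * h) : Set (ℝ × ℝ)) =ᵐ[volume]
        ((B ×ˢ Ioc c (c + n * h)) ∪ (B ×ˢ Ioc (c + n * h) (c + (n + 1 : ℕ) * h)) : Set _) := by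
      rw [← prod_union, Ioc_union_Ioc_eq_Ioc (by linarith) (by push_cast; nlinarith)]
      exact Measure.set_prod_ae_eq (Filter.EventuallyEq.refl _ _) Ioo_ae_eq_Ioc
    rw [Measure.restrict_congr_set e, Measure.restrict_union _ (hB.prod measurableSet_Ioc)]
    · congr 1
      · exact Measure.restrict_congr_set
          (Measure.set_prod_ae_eq (Filter.EventuallyEq.refl _ _) Ioo_ae_eq_Ioc.symm)
      · rw [map_add_right_restrict (T := B ×ˢ Ioo (c + n * h) (c + (n + 1 : ℕ) * h))]
        · exact Measure.restrict_congr_set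
            (Measure.set_prod_ae_eq (Filter.EventuallyEq.refl _ _) Ioo_ae_eq_Ioc.symm)
        · ext x
          simp only [mem_preimage, mem_prod, mem_Ioo, Prod.fst_add, Prod.snd_add, add_zero]
          push_cast
          constructor <;> rintro ⟨h3, ⟨h1, h2⟩⟩ <;> refine ⟨h3, ⟨?_, ?_⟩⟩ <;> linarith
    · exact Disjoint.set_prod_right (Ioc_disjoint_Ioc_of_le le_rfl) _ _

/-! ### Functions that acquire a constant factor under translation -/

section Quasiperiodic

variable {ι : Type*} {μ ν : Measure (ℝ × ℝ)} {s : Finset ι} {v : ι → ℝ × ℝ} {G : ℝ × ℝ → ℂ}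
  {z : ι → ℂ}

theorem integrable_sum_map (hν : ν = ∑ p ∈ s, μ.map (fun x => x + v p))
    (hG : ∀ p ∈ s, ∀ x, G (x + v p) = z p * G x) (h : Integrable G μ) : Integrable G ν := by
  rw [hν, integrable_finsetSum_measure]
  intro p hp
  rw [(measurableEmbedding_addRight (v p)).integrable_map_iff]
  exact (h.const_mul (z p)).congr (ae_of_all _ fun x => (hG p hp x).symm)

/-- Each translate contributes the same integral times its factor `z p`. For Bloch waves the sum of
factors becomes a geometric sum. -/
theorem integral_sum_map (hν : ν = ∑ p ∈ s, μ.map (fun x => x + v p))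
    (hG : ∀ p ∈ s, ∀ x, G (x + v p) = z p * G x) (h : Integrable G μ) :
    ∫ x, G x ∂ν = (∑ p ∈ s, z p) * ∫ x, G x ∂μ := by
  have hi := integrable_sum_map hν hG h
  rw [hν, integrable_finsetSum_measure] at hi
  rw [hν, integral_finsetSum_measure hi, Finset.sum_mul]
  refine Finset.sum_congr rfl fun p hp => ?_
  rw [(measurableEmbedding_addRight (v p)).integral_map, ← integral_const_mul]
  exact integral_congr_ae (ae_of_all _ fun x => hG p hp x)

theorem aestronglyMeasurable_finsetSum_measure {α E κ : Type*} [MeasurableSpace α]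
    [TopologicalSpace E] [TopologicalSpace.PseudoMetrizableSpace E] {f : α → E} {m : κ → Measure α}
    {t : Finset κ} (h : ∀ i ∈ t, AEStronglyMeasurable f (m i)) :
    AEStronglyMeasurable f (∑ i ∈ t, m i) := by
  rw [← Measure.sum_coe_finset, aestronglyMeasurable_sum_measure_iff]
  exact fun i => h i i.2

theorem memLp_sum_map (hν : ν = ∑ p ∈ s, μ.map (fun x => x + v p))
    (hG : ∀ p ∈ s, ∀ x, G (x + v p) = z p * G x) (h : MemLp G 2 μ) : MemLp G 2 ν := by
  have hm : ∀ p ∈ s, MemLp G 2 (μ.map (fun x => x + v p)) := by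
    intro p hp
    rw [(measurableEmbedding_addRight (v p)).memLp_map_measure_iff]
    exact (h.const_mul (z p)).ae_eq (ae_of_all _ fun x => (hG p hp x).symm)
  have hs : AEStronglyMeasurable G ν := by
    rw [hν]
    exact aestronglyMeasurable_finsetSum_measure fun p hp => (hm p hp).1
  rw [memLp_two_iff_integrable_sq_norm hs, hν, integrable_finsetSum_measure]
  exact fun p hp => (memLp_two_iff_integrable_sq_norm (hm p hp).1).1 (hm p hp)

end Quasiperiodic

/-! ### Quasiperiodic functions on the reference box -/

/-- `G` is multiplied by `z₁`, `z₂` under translation by `ε` in the two coordinate directions. -/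
def Quasiperiodic (ε : ℝ) (z₁ z₂ : ℂ) (G : ℝ × ℝ → ℂ) : Prop :=
  (∀ x, G (x + (ε, 0)) = z₁ * G x) ∧ ∀ x, G (x + (0, ε)) = z₂ * G x

theorem Quasiperiodic.fst_nat {ε : ℝ} {z₁ z₂ : ℂ} {G : ℝ × ℝ → ℂ} (h : Quasiperiodic ε z₁ z₂ G)
    (p : ℕ) (x : ℝ × ℝ) : G (x + (p * ε, 0)) = z₁ ^ p * G x := by
  induction p with
  | zero => simp [← Prod.zero_eq_mk]
  | succ p ih =>
    have : x + (((p + 1 : ℕ) * ε, 0) : ℝ × ℝ) = (x + (p * ε, 0)) + (ε, 0) := by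
      ext <;> simp; ring
    rw [this, h.1, ih, pow_succ]; ring

theorem Quasiperiodic.snd_nat {ε : ℝ} {z₁ z₂ : ℂ} {G : ℝ × ℝ → ℂ} (h : Quasiperiodic ε z₁ z₂ G)
    (p : ℕ) (x : ℝ × ℝ) : G (x + (0, p * ε)) = z₂ ^ p * G x := by
  induction p with
  | zero => simp [← Prod.zero_eq_mk]
  | succ p ih =>
    have : x + ((0, (p + 1 : ℕ) * ε) : ℝ × ℝ) = (x + (0, p * ε)) + (0, ε) := by
      ext <;> simp; ring
    rw [this, h.2, ih, pow_succ]; ring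

theorem Quasiperiodic.mul {ε : ℝ} {z₁ z₂ w₁ w₂ : ℂ} {F G : ℝ × ℝ → ℂ}
    (hF : Quasiperiodic ε z₁ z₂ F) (hG : Quasiperiodic ε w₁ w₂ G) :
    Quasiperiodic ε (z₁ * w₁) (z₂ * w₂) (fun x => F x * G x) :=
  ⟨fun x => by simp only [hF.1, hG.1]; ring, fun x => by simp only [hF.2, hG.2]; ring⟩

theorem Quasiperiodic.conj {ε : ℝ} {z₁ z₂ : ℂ} {F : ℝ × ℝ → ℂ} (hF : Quasiperiodic ε z₁ z₂ F) :
    Quasiperiodic ε (conj z₁) (conj z₂) (fun x => conj (F x)) :=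
  ⟨fun x => by simp only [hF.1, map_mul], fun x => by simp only [hF.2, map_mul]⟩

theorem CellPeriodic.quasiperiodic {ε : ℝ} {F : ℝ × ℝ → ℂ} (hF : CellPeriodic ε F) :
    Quasiperiodic ε 1 1 F :=
  ⟨fun x => by rw [one_mul, hF.1], fun x => by rw [one_mul, hF.2]⟩

theorem restrict_slab_eq_sum {ε : ℝ} (hε : 0 < ε) (L : ℕ) :
    volume.restrict (rect 0 (ε * L) ε) =
      ∑ p ∈ Finset.range L,
        (volume.restrict (cell ε)).map (fun x => x + ((p * ε, 0) : ℝ × ℝ)) := by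
  simpa [rect, cell, mul_comm] using restrict_Ioo_prod_eq_sum 0 ε hε (B := Ioo 0 ε) measurableSet_Ioo L

theorem restrict_box_eq_sum {ε : ℝ} (hε : 0 < ε) (L K : ℕ) :
    volume.restrict (box ε L K) =
      ∑ q ∈ Finset.range K,
        (volume.restrict (rect 0 (ε * L) ε)).map (fun x => x + ((0, q * ε) : ℝ × ℝ)) := by
  simpa [rect, box, mul_comm] using
    restrict_prod_Ioo_eq_sum 0 ε hε (B := Ioo 0 (ε * L)) measurableSet_Ioo K

theorem Quasiperiodic.memLp_box {ε : ℝ} (hε : 0 < ε) {z₁ z₂ : ℂ} {G : ℝ × ℝ → ℂ}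
    (h : Quasiperiodic ε z₁ z₂ G) (L K : ℕ) (hG : MemLp G 2 (volume.restrict (cell ε))) :
    MemLp G 2 (volume.restrict (box ε L K)) :=
  memLp_sum_map (restrict_box_eq_sum hε L K) (fun q _ x => h.snd_nat q x)
    (memLp_sum_map (restrict_slab_eq_sum hε L) (fun p _ x => h.fst_nat p x) hG)

theorem Quasiperiodic.integrableOn_box {ε : ℝ} (hε : 0 < ε) {z₁ z₂ : ℂ} {G : ℝ × ℝ → ℂ}
    (h : Quasiperiodic ε z₁ z₂ G) (L K : ℕ) (hG : IntegrableOn G (cell ε)) :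
    IntegrableOn G (box ε L K) :=
  integrable_sum_map (restrict_box_eq_sum hε L K) (fun q _ x => h.snd_nat q x)
    (integrable_sum_map (restrict_slab_eq_sum hε L) (fun p _ x => h.fst_nat p x) hG)

theorem Quasiperiodic.integral_box {ε : ℝ} (hε : 0 < ε) {z₁ z₂ : ℂ} {G : ℝ × ℝ → ℂ}
    (h : Quasiperiodic ε z₁ z₂ G) (L K : ℕ) (hG : IntegrableOn G (cell ε)) :
    ∫ x in box ε L K, G x = (∑ q ∈ Finset.range K, z₂ ^ q) * ((∑ p ∈ Finset.range L, z₁ ^ p) *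
      ∫ x in cell ε, G x) := by
  rw [integral_sum_map (restrict_box_eq_sum hε L K) (fun q _ x => h.snd_nat q x)
    (integrable_sum_map (restrict_slab_eq_sum hε L) (fun p _ x => h.fst_nat p x) hG),
    integral_sum_map (restrict_slab_eq_sum hε L) (fun p _ x => h.fst_nat p x) hG]

/-- The `k`-th power of the standard primitive `N`-th root of unity. -/
noncomputable def rootPow (N k : ℕ) : ℂ := Complex.exp (2 * Real.pi * Complex.I / N) ^ k

theorem conj_rootPow_mul_self (N k : ℕ) : conj (rootPow N k) * rootPow N k = 1 := by
  rw [rootPow, map_pow, ← mul_pow, ← Complex.exp_conj, ← Complex.exp_add]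
  simp [neg_div, Complex.conj_ofNat]

theorem geom_sum_rootPow_self (N M k : ℕ) :
    ∑ p ∈ Finset.range M, (conj (rootPow N k) * rootPow N k) ^ p = M := by
  simp [conj_rootPow_mul_self]

/-- The ratio is an `N`-th root of unity, and it differs from 1 because `k` and `k'` are distinct
exponents below `N`. The closed form of the geometric sum then has numerator zero. -/
theorem geom_sum_rootPow_of_ne {N k k' : ℕ} (hk : k < N) (hk' : k' < N) (h : k ≠ k') :
    ∑ p ∈ Finset.range N, (conj (rootPow N k) * rootPow N k') ^ p = 0 := by
  have hN : N ≠ 0 := by omega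
  have hp := Complex.isPrimitiveRoot_exp N hN
  have h1 : ∀ m, rootPow N m ^ N = 1 := fun m => by
    rw [rootPow, pow_right_comm, hp.pow_eq_one, one_pow]
  have hne : conj (rootPow N k) * rootPow N k' ≠ 1 := by
    intro e
    apply h
    apply hp.pow_inj hk hk'
    have h0 : conj (rootPow N k) ≠ 0 := fun h0 => by simp [h0] at e
    exact mul_left_cancel₀ h0 ((conj_rootPow_mul_self N k).trans e.symm)
  rw [geom_sum_eq hne, mul_pow, ← map_pow, h1, h1]
  simp

/-- Different wave vectors differ in at least one component, and the geometric sum in that direction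
vanishes. No property of `G` inside the cell matters beyond integrability, so periodic weights are
allowed. -/
theorem integral_box_of_ne {ε : ℝ} (hε : 0 < ε) {L K : ℕ} {k k' : Fin L × Fin K} (hk : k ≠ k')
    {G : ℝ × ℝ → ℂ}
    (h : Quasiperiodic ε (conj (rootPow L k.1) * rootPow L k'.1)
      (conj (rootPow K k.2) * rootPow K k'.2) G) (hG : IntegrableOn G (cell ε)) :
    ∫ x in box ε L K, G x = 0 := by
  rw [h.integral_box hε L K hG]
  by_cases h1 : (k.1 : ℕ) = k'.1
  · have h2 : (k.2 : ℕ) ≠ k'.2 := fun h2 => hk (Prod.ext (Fin.ext h1) (Fin.ext h2))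
    rw [geom_sum_rootPow_of_ne k.2.2 k'.2.2 h2, zero_mul]
  · rw [geom_sum_rootPow_of_ne k.1.2 k'.1.2 h1, zero_mul, mul_zero]

theorem integral_box_of_eq {ε : ℝ} (hε : 0 < ε) {L K : ℕ} {k : Fin L × Fin K}
    {G : ℝ × ℝ → ℂ}
    (h : Quasiperiodic ε (conj (rootPow L k.1) * rootPow L k.1)
      (conj (rootPow K k.2) * rootPow K k.2) G) (hG : IntegrableOn G (cell ε)) :
    ∫ x in box ε L K, G x = L * K * ∫ x in cell ε, G x := by
  rw [h.integral_box hε L K hG, geom_sum_rootPow_self, geom_sum_rootPow_self]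
  ring

/-! ### Bloch waves -/

theorem phase_add_fst {ε : ℝ} (hε : 0 < ε) {L K : ℕ} (k : Fin L × Fin K) (x : ℝ × ℝ) :
    phase ε (waveVector k) (x + (ε, 0)) = rootPow L k.1 * phase ε (waveVector k) x := by
  have : (ε : ℂ) ≠ 0 := by exact_mod_cast hε.ne'
  rw [phase, phase, rootPow, ← Complex.exp_nat_mul, ← Complex.exp_add]
  congr 1
  simp only [shift, waveVector, Prod.fst_add, Prod.snd_add, add_zero]
  push_cast
  field_simp
  ring

theorem phase_add_snd {ε : ℝ} (hε : 0 < ε) {L K : ℕ} (k : Fin L × Fin K) (x : ℝ × ℝ) :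
    phase ε (waveVector k) (x + (0, ε)) = rootPow K k.2 * phase ε (waveVector k) x := by
  have : (ε : ℂ) ≠ 0 := by exact_mod_cast hε.ne'
  rw [phase, phase, rootPow, ← Complex.exp_nat_mul, ← Complex.exp_add]
  congr 1
  simp only [shift, waveVector, Prod.fst_add, Prod.snd_add, add_zero]
  push_cast
  field_simp
  ring

theorem CellPeriodic.mul_phase {ε : ℝ} (hε : 0 < ε) {L K : ℕ} (k : Fin L × Fin K)
    {F : ℝ × ℝ → ℂ} (hF : CellPeriodic ε F) :
    Quasiperiodic ε (rootPow L k.1) (rootPow K k.2) (fun x => F x * phase ε (waveVector k) x) := by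
  have := hF.quasiperiodic.mul (F := F) (G := phase ε (waveVector k))
    ⟨phase_add_fst hε k, phase_add_snd hε k⟩
  simpa using this

theorem norm_phase (ε : ℝ) (j x : ℝ × ℝ) : ‖phase ε j x‖ = 1 := by
  have : shift ε (j.1 * x.1 + j.2 * x.2) =
      ((2 * Real.pi * (j.1 * x.1 + j.2 * x.2) / ε : ℝ) : ℂ) * Complex.I := by
    simp only [shift]; push_cast; ring
  rw [phase, this, Complex.norm_exp_ofReal_mul_I]

theorem contDiff_phase (ε : ℝ) (j : ℝ × ℝ) : ContDiff ℝ (⊤ : ℕ∞) (phase ε j) := by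
  unfold phase shift
  have h : ContDiff ℝ (⊤ : ℕ∞) (fun x : ℝ × ℝ => ((j.1 * x.1 + j.2 * x.2 : ℝ) : ℂ)) :=
    Complex.ofRealCLM.contDiff.comp
      ((contDiff_const.mul contDiff_fst).add (contDiff_const.mul contDiff_snd))
  exact (((contDiff_const.mul h).div_const _)).cexp

theorem fderiv_phase (ε : ℝ) (j x v : ℝ × ℝ) :
    fderiv ℝ (phase ε j) x v = shift ε (j.1 * v.1 + j.2 * v.2) * phase ε j x := by
  have h1 : HasFDerivAt (fun x : ℝ × ℝ => j.1 * x.1 + j.2 * x.2)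
      (j.1 • ContinuousLinearMap.fst ℝ ℝ ℝ + j.2 • ContinuousLinearMap.snd ℝ ℝ ℝ) x :=
    (hasFDerivAt_fst.const_mul _).add (hasFDerivAt_snd.const_mul _)
  have h2 := ((Complex.ofRealCLM.hasFDerivAt.comp x h1).const_mul
    (2 * Real.pi * Complex.I / ε : ℂ)).cexp
  have h3 : phase ε j = fun x => Complex.exp ((2 * Real.pi * Complex.I / ε : ℂ) *
      (Complex.ofRealCLM ∘ fun x : ℝ × ℝ => j.1 * x.1 + j.2 * x.2) x) := by
    funext y
    simp only [phase, shift, Function.comp, Complex.ofRealCLM_apply]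
    congr 1; ring
  rw [h3, h2.fderiv]
  simp [shift]
  ring

theorem memLp_mul_phase {ε : ℝ} {F : ℝ × ℝ → ℂ} {μ : Measure (ℝ × ℝ)} (j : ℝ × ℝ)
    (hF : MemLp F 2 μ) : MemLp (fun x => F x * phase ε j x) 2 μ := by
  refine hF.of_le (hF.1.mul (contDiff_phase ε j).continuous.aestronglyMeasurable)
    (ae_of_all _ fun x => ?_)
  rw [norm_mul, norm_phase, mul_one]

theorem H1Cell.memLp_D₁ {ε : ℝ} (Ψ : H1Cell ε) (j : ℝ × ℝ) :
    MemLp (Ψ.D₁ j) 2 (volume.restrict (cell ε)) :=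
  Ψ.memLp_d₁.add (Ψ.memLp_val.const_mul _)

theorem H1Cell.cellPeriodic_D₁ {ε : ℝ} (Ψ : H1Cell ε) (j : ℝ × ℝ) : CellPeriodic ε (Ψ.D₁ j) :=
  ⟨fun x => by simp only [D₁, Ψ.periodic_d₁.1 x, Ψ.periodic_val.1 x],
    fun x => by simp only [D₁, Ψ.periodic_d₁.2 x, Ψ.periodic_val.2 x]⟩

section

variable {ε : ℝ} {L K : ℕ} (Ψ : Fin L × Fin K → ℕ → H1Cell ε) (lam : BlochIndex L K)

theorem quasiperiodic_blochWave (hε : 0 < ε) :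
    Quasiperiodic ε (rootPow L lam.1.1) (rootPow K lam.1.2) (blochWave Ψ lam) :=
  (Ψ lam.1 lam.2).periodic_val.mul_phase hε lam.1

theorem quasiperiodic_blochWaveD₁ (hε : 0 < ε) :
    Quasiperiodic ε (rootPow L lam.1.1) (rootPow K lam.1.2) (blochWaveD₁ Ψ lam) :=
  ((Ψ lam.1 lam.2).cellPeriodic_D₁ _).mul_phase hε lam.1

theorem memLp_cell_blochWave : MemLp (blochWave Ψ lam) 2 (volume.restrict (cell ε)) :=
  memLp_mul_phase _ (Ψ lam.1 lam.2).memLp_val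

theorem memLp_cell_blochWaveD₁ : MemLp (blochWaveD₁ Ψ lam) 2 (volume.restrict (cell ε)) :=
  memLp_mul_phase _ ((Ψ lam.1 lam.2).memLp_D₁ _)

theorem memLp_box_blochWave (hε : 0 < ε) :
    MemLp (blochWave Ψ lam) 2 (volume.restrict (box ε L K)) :=
  (quasiperiodic_blochWave Ψ lam hε).memLp_box hε L K (memLp_cell_blochWave Ψ lam)

theorem memLp_box_blochWaveD₁ (hε : 0 < ε) :
    MemLp (blochWaveD₁ Ψ lam) 2 (volume.restrict (box ε L K)) :=
  (quasiperiodic_blochWaveD₁ Ψ lam hε).memLp_box hε L K (memLp_cell_blochWaveD₁ Ψ lam)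

end

/-! ### Test functions and weak derivatives -/

theorem measurableSet_rect (l r H : ℝ) : MeasurableSet (rect l r H) :=
  measurableSet_Ioo.prod measurableSet_Ioo

theorem isOpen_rect (l r H : ℝ) : IsOpen (rect l r H) := isOpen_Ioo.prod isOpen_Ioo

theorem volume_rect_lt_top (l r H : ℝ) : volume (rect l r H) < ⊤ := by
  rw [rect, Measure.volume_eq_prod, Measure.prod_prod]
  exact ENNReal.mul_lt_top measure_Ioo_lt_top measure_Ioo_lt_top

instance (l r H : ℝ) : IsFiniteMeasure (volume.restrict (rect l r H)) :=
  isFiniteMeasure_restrict.2 (volume_rect_lt_top l r H).ne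

instance (ε : ℝ) (L K : ℕ) : IsFiniteMeasure (volume.restrict (box ε L K)) := by
  unfold box; infer_instance

theorem IsTest.mono {D D' : Set (ℝ × ℝ)} {φ : ℝ × ℝ → ℂ} (h : IsTest D φ) (hD : D ⊆ D') :
    IsTest D' φ :=
  ⟨h.smooth, h.compact, h.subset.trans hD⟩

theorem IsTest.continuous_fderiv {D : Set (ℝ × ℝ)} {φ : ℝ × ℝ → ℂ} (h : IsTest D φ) (v : ℝ × ℝ) :
    Continuous (fun x => fderiv ℝ φ x v) :=
  (h.smooth.continuous_fderiv (by simp)).clm_apply continuous_const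

theorem IsTest.hasCompactSupport_fderiv {D : Set (ℝ × ℝ)} {φ : ℝ × ℝ → ℂ} (h : IsTest D φ)
    (v : ℝ × ℝ) : HasCompactSupport (fun x => fderiv ℝ φ x v) :=
  h.compact.fderiv_apply ℝ v

theorem IsTest.support_subset {D : Set (ℝ × ℝ)} {φ : ℝ × ℝ → ℂ} (h : IsTest D φ) :
    Function.support φ ⊆ D :=
  (subset_tsupport φ).trans h.subset

theorem IsTest.support_fderiv_subset {D : Set (ℝ × ℝ)} {φ : ℝ × ℝ → ℂ} (h : IsTest D φ)
    (v : ℝ × ℝ) : Function.support (fun x => fderiv ℝ φ x v) ⊆ D := by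
  refine Subset.trans (fun x hx => ?_) ((_root_.support_fderiv_subset ℝ).trans h.subset)
  intro h0
  exact hx (by simp [h0])

theorem setIntegral_mul_eq_of_support_subset {D D' : Set (ℝ × ℝ)} (hD' : MeasurableSet D')
    (hD : D ⊆ D') {ψ : ℝ × ℝ → ℂ} (hψ : Function.support ψ ⊆ D) (F : ℝ × ℝ → ℂ) :
    ∫ x in D', F x * ψ x = ∫ x in D, F x * ψ x := by
  refine setIntegral_eq_of_subset_of_forall_sdiff_eq_zero hD' hD fun x hx => ?_
  rw [Function.notMem_support.1 fun h => hx.2 (hψ h), mul_zero]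

theorem integrable_mul_of_memLp {α : Type*} [MeasurableSpace α] {μ : Measure α} {F G : α → ℂ}
    (hF : MemLp F 2 μ) (hG : MemLp G 2 μ) : Integrable (fun x => F x * G x) μ :=
  hF.integrable_mul hG

theorem IsTest.memLp {D : Set (ℝ × ℝ)} {φ : ℝ × ℝ → ℂ} (h : IsTest D φ) (μ : Measure (ℝ × ℝ))
    [IsFiniteMeasureOnCompacts μ] : MemLp φ 2 μ :=
  h.smooth.continuous.memLp_of_hasCompactSupport h.compact

theorem IsTest.memLp_fderiv {D : Set (ℝ × ℝ)} {φ : ℝ × ℝ → ℂ} (h : IsTest D φ) (v : ℝ × ℝ)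
    (μ : Measure (ℝ × ℝ)) [IsFiniteMeasureOnCompacts μ] : MemLp (fun x => fderiv ℝ φ x v) 2 μ :=
  (h.continuous_fderiv v).memLp_of_hasCompactSupport (h.hasCompactSupport_fderiv v)

/-- The fundamental lemma of the calculus of variations; it gives uniqueness of weak derivatives.
Real-valued bump functions, regarded as complex ones, already suffice. -/
theorem ae_eq_of_forall_isTest {l r H : ℝ} {g g' : ℝ × ℝ → ℂ}
    (hg : MemLp g 2 (volume.restrict (rect l r H))) (hg' : MemLp g' 2 (volume.restrict (rect l r H)))
    (h : ∀ φ, IsTest (rect l r H) φ →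
      ∫ x in rect l r H, g x * φ x = ∫ x in rect l r H, g' x * φ x) :
    g =ᵐ[volume.restrict (rect l r H)] g' := by
  have hi : IntegrableOn (fun x => g x - g' x) (rect l r H) volume :=
    (hg.sub hg').integrable (by norm_num)
  have key := (isOpen_rect l r H).ae_eq_zero_of_integral_contDiff_smul_eq_zero (μ := volume)
    hi.locallyIntegrableOn ?_
  · rw [Filter.EventuallyEq, ae_restrict_iff' (measurableSet_rect l r H)]
    filter_upwards [key] with x hx hxD
    exact sub_eq_zero.1 (hx hxD)
  · intro φ hφ hc hs
    have hts : tsupport (fun x => (φ x : ℂ)) ⊆ tsupport φ :=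
      closure_mono fun x hx h0 => hx (by simp [h0])
    have ht : IsTest (rect l r H) (fun x => (φ x : ℂ)) :=
      ⟨Complex.ofRealCLM.contDiff.comp hφ, hc.of_isClosed_subset (isClosed_tsupport _) hts,
        hts.trans hs⟩
    have h1 := h _ ht
    have h2 : ∫ x in rect l r H, (g x - g' x) * (φ x : ℂ) = 0 := by
      simp only [sub_mul]
      rw [integral_sub (integrable_mul_of_memLp hg (ht.memLp _))
        (integrable_mul_of_memLp hg' (ht.memLp _)), h1, sub_self]
    rw [setIntegral_mul_eq_of_support_subset (D := rect l r H) MeasurableSet.univ (subset_univ _)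
      ht.support_subset (fun x => g x - g' x) |>.symm, setIntegral_univ] at h2
    rw [← h2]
    refine integral_congr_ae (ae_of_all _ fun x => ?_)
    simp [mul_comm]

/-! ### The horizontal derivative of a combination of Bloch waves -/

section

variable {ε : ℝ} {L K : ℕ} (Ψ : Fin L × Fin K → ℕ → H1Cell ε)

/-- The weak gradient of Ψ is tested with phase·φ. The product rule produces the extra term with
`shift ε j.1`, which is exactly the difference between `d₁` and `D₁`. -/
theorem integral_blochWave_mul_fderiv (hε : 0 < ε) (lam : BlochIndex L K) {φ : ℝ × ℝ → ℂ}
    (hφ : IsTest (box ε L K) φ) :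
    ∫ x in box ε L K, blochWave Ψ lam x * fderiv ℝ φ x (1, 0) =
      -∫ x in box ε L K, blochWaveD₁ Ψ lam x * φ x := by
  set j := waveVector lam.1
  set Φ := Ψ lam.1 lam.2 with hΦ
  have hP := contDiff_phase ε j
  have hsub : tsupport (fun x => phase ε j x * φ x) ⊆ tsupport φ :=
    closure_mono fun x hx h0 => hx (by simp [h0])
  have hχ : IsTest (box ε L K) (fun x => phase ε j x * φ x) :=
    ⟨hP.mul hφ.smooth, hφ.compact.of_isClosed_subset (isClosed_tsupport _) hsub,
      hsub.trans hφ.subset⟩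
  have hder : ∀ x, fderiv ℝ (fun x => phase ε j x * φ x) x (1, 0) =
      phase ε j x * fderiv ℝ φ x (1, 0) + shift ε j.1 * phase ε j x * φ x := by
    intro x
    rw [fderiv_fun_mul (hP.differentiable (by simp) x) (hφ.smooth.differentiable (by simp) x)]
    simp [fderiv_phase, smul_eq_mul]
    ring
  have h := (Φ.weakGrad _ (hχ.mono (subset_univ _))).1
  rw [setIntegral_mul_eq_of_support_subset MeasurableSet.univ (subset_univ (box ε L K))
      (hχ.support_fderiv_subset _),
    setIntegral_mul_eq_of_support_subset MeasurableSet.univ (subset_univ (box ε L K))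
      hχ.support_subset] at h
  have hv : MemLp Φ.val 2 (volume.restrict (box ε L K)) :=
    Φ.periodic_val.quasiperiodic.memLp_box hε L K Φ.memLp_val
  have hd : MemLp Φ.d₁ 2 (volume.restrict (box ε L K)) :=
    Φ.periodic_d₁.quasiperiodic.memLp_box hε L K Φ.memLp_d₁
  have i1 : IntegrableOn (fun x => Φ.val x * fderiv ℝ (fun x => phase ε j x * φ x) x (1, 0))
      (box ε L K) := integrable_mul_of_memLp hv (hχ.memLp_fderiv _ _)
  have i2 : IntegrableOn (fun x => Φ.val x * (phase ε j x * φ x)) (box ε L K) :=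
    integrable_mul_of_memLp hv (hχ.memLp _)
  have i3 : IntegrableOn (fun x => Φ.d₁ x * (phase ε j x * φ x)) (box ε L K) :=
    integrable_mul_of_memLp hd (hχ.memLp _)
  calc ∫ x in box ε L K, blochWave Ψ lam x * fderiv ℝ φ x (1, 0)
      = ∫ x in box ε L K, (Φ.val x * fderiv ℝ (fun x => phase ε j x * φ x) x (1, 0) -
          shift ε j.1 * (Φ.val x * (phase ε j x * φ x))) := by
        refine integral_congr_ae (ae_of_all _ fun x => ?_)
        simp only [hder, blochWave]
        ring
    _ = -∫ x in box ε L K, (Φ.d₁ x * (phase ε j x * φ x) +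
          shift ε j.1 * (Φ.val x * (phase ε j x * φ x))) := by
        rw [integral_sub i1 (i2.const_mul _), integral_add i3 (i2.const_mul _), h]
        ring
    _ = _ := by
        congr 1
        refine integral_congr_ae (ae_of_all _ fun x => ?_)
        simp only [blochWaveD₁, H1Cell.D₁]
        ring

/-- Membership in the Bloch span constrains only the values of `w`, while the flux involves its
derivative. Uniqueness of the weak derivative inside the box transfers the expansion. -/
theorem d₁_ae_eq_sum (hε : 0 < ε) (s : Finset (BlochIndex L K)) (α : BlochIndex L K → ℂ)
    (w : H1Strip 0 (ε * L) (ε * K))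
    (hw : w.val =ᵐ[volume.restrict (box ε L K)] fun x => ∑ lam ∈ s, α lam * blochWave Ψ lam x) :
    w.d₁ =ᵐ[volume.restrict (box ε L K)] fun x => ∑ lam ∈ s, α lam * blochWaveD₁ Ψ lam x := by
  refine ae_eq_of_forall_isTest w.memLp_d₁
    (memLp_finsetSum s fun lam _ => (memLp_box_blochWaveD₁ Ψ lam hε).const_mul _) fun φ hφ => ?_
  change IsTest (box ε L K) φ at hφ
  change ∫ x in box ε L K, _ = ∫ x in box ε L K, _
  have hsub : box ε L K ⊆ Ioo 0 (ε * L) ×ˢ univ := prod_mono_right (subset_univ _)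
  have hm : MeasurableSet (Ioo 0 (ε * L) ×ˢ (univ : Set ℝ)) :=
    measurableSet_Ioo.prod MeasurableSet.univ
  have h := (w.weakGrad φ (hφ.mono hsub)).1
  rw [setIntegral_mul_eq_of_support_subset hm hsub (hφ.support_fderiv_subset _),
    setIntegral_mul_eq_of_support_subset hm hsub hφ.support_subset] at h
  have h1 : ∫ x in box ε L K, w.val x * fderiv ℝ φ x (1, 0) =
      ∫ x in box ε L K, ∑ lam ∈ s, α lam * (blochWave Ψ lam x * fderiv ℝ φ x (1, 0)) := by
    refine integral_congr_ae ?_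
    filter_upwards [hw] with x hx
    rw [hx, Finset.sum_mul]
    exact Finset.sum_congr rfl fun _ _ => mul_assoc _ _ _
  have h2 : ∫ x in box ε L K, (∑ lam ∈ s, α lam * blochWaveD₁ Ψ lam x) * φ x =
      ∫ x in box ε L K, ∑ lam ∈ s, α lam * (blochWaveD₁ Ψ lam x * φ x) := by
    congr 1; funext x
    rw [Finset.sum_mul]
    exact Finset.sum_congr rfl fun _ _ => mul_assoc _ _ _
  rw [h1, integral_finsetSum _ fun lam _ => (integrable_mul_of_memLp
    (memLp_box_blochWave Ψ lam hε) (hφ.memLp_fderiv _ _)).const_mul _] at h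
  rw [h2, integral_finsetSum _ fun lam _ => (integrable_mul_of_memLp
    (memLp_box_blochWaveD₁ Ψ lam hε) (hφ.memLp _)).const_mul _, ← neg_inj, ← h,
    ← Finset.sum_neg_distrib]
  refine Finset.sum_congr rfl fun lam _ => ?_
  rw [integral_const_mul, integral_const_mul, integral_blochWave_mul_fderiv Ψ hε lam hφ, mul_neg]

end

/-! ### Orthogonality of Bloch waves with different wave vectors -/

/-- All off-diagonal terms cancel because the wave vectors are distinct. Two families `F` and `G`
are kept apart so that one statement serves both the L² norm (`F = G`) and the flux (`G` is the
weighted derivative). -/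
theorem integral_box_conj_sum_mul_sum {ε : ℝ} (hε : 0 < ε) {L K : ℕ} (s : Finset (BlochIndex L K))
    (hs : ∀ lam ∈ s, ∀ mu ∈ s, lam ≠ mu → lam.1 ≠ mu.1) (α : BlochIndex L K → ℂ)
    {F G : BlochIndex L K → ℝ × ℝ → ℂ}
    (hF : ∀ lam, Quasiperiodic ε (rootPow L lam.1.1) (rootPow K lam.1.2) (F lam))
    (hG : ∀ lam, Quasiperiodic ε (rootPow L lam.1.1) (rootPow K lam.1.2) (G lam))
    (hF2 : ∀ lam, MemLp (F lam) 2 (volume.restrict (cell ε)))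
    (hG2 : ∀ lam, MemLp (G lam) 2 (volume.restrict (cell ε))) :
    ∫ x in box ε L K, conj (∑ lam ∈ s, α lam * F lam x) * ∑ lam ∈ s, α lam * G lam x =
      ∑ lam ∈ s, ((‖α lam‖ ^ 2 * (L * K) : ℝ) : ℂ) * ∫ x in cell ε, conj (F lam x) * G lam x := by
  have hq : ∀ lam mu, Quasiperiodic ε (conj (rootPow L lam.1.1) * rootPow L mu.1.1)
      (conj (rootPow K lam.1.2) * rootPow K mu.1.2) (fun x => conj (F lam x) * G mu x) :=
    fun lam mu => (hF lam).conj.mul (hG mu)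
  have hi : ∀ lam mu, IntegrableOn (fun x => conj (F lam x) * G mu x) (cell ε) :=
    fun lam mu => integrable_mul_of_memLp (hF2 lam).star (hG2 mu)
  have e : ∀ x, conj (∑ lam ∈ s, α lam * F lam x) * ∑ lam ∈ s, α lam * G lam x =
      ∑ lam ∈ s, ∑ mu ∈ s, conj (α lam) * α mu * (conj (F lam x) * G mu x) := by
    intro x
    rw [map_sum, Finset.sum_mul_sum]
    refine Finset.sum_congr rfl fun lam _ => Finset.sum_congr rfl fun mu _ => ?_
    rw [map_mul]; ring
  have hib : ∀ lam mu, IntegrableOn (fun x => conj (α lam) * α mu * (conj (F lam x) * G mu x))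
      (box ε L K) := fun lam mu => ((hq lam mu).integrableOn_box hε L K (hi lam mu)).const_mul _
  simp only [e]
  rw [integral_finsetSum _ fun lam _ => integrable_finsetSum _ fun mu _ => hib lam mu]
  refine Finset.sum_congr rfl fun lam hlam => ?_
  rw [integral_finsetSum _ fun mu _ => hib lam mu, Finset.sum_eq_single_of_mem lam hlam]
  · rw [integral_const_mul, integral_box_of_eq hε (hq lam lam) (hi lam lam), ← mul_assoc]
    congr 1
    push_cast
    rw [← Complex.conj_mul']
  · intro mu hmu hne
    rw [integral_const_mul, integral_box_of_ne hε (hs lam hlam mu hmu hne.symm) (hq lam mu)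
      (hi lam mu), mul_zero]

theorem ofReal_mul_memLp {μ : Measure (ℝ × ℝ)} {b : ℝ × ℝ → ℝ} {F : ℝ × ℝ → ℂ} {A : ℝ}
    (hb : AEStronglyMeasurable b μ) (hA : ∀ᵐ x ∂μ, |b x| ≤ A) (hF : MemLp F 2 μ) :
    MemLp (fun x => (b x : ℂ) * F x) 2 μ := by
  refine hF.of_le_mul (c := A)
    ((Complex.continuous_ofReal.comp_aestronglyMeasurable hb).mul hF.1) ?_
  filter_upwards [hA] with x hx
  rw [norm_mul, Complex.norm_real, Real.norm_eq_abs]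
  gcongr

/-- The flux of a combination of admissible Bloch waves controls its `L²` norm. -/
theorem flux_lower_bound {ε : ℝ} (hε : 0 < ε) {L K : ℕ} {s c₀ C₀ A : ℝ} {b : ℝ × ℝ → ℝ}
    {Ψ : Fin L × Fin K → ℕ → H1Cell ε} {I : Set (BlochIndex L K)}
    (hΨ : ∀ k, IsBlochFamily ε b (waveVector k) (Ψ k)) (hI : IsAdmissible s b Ψ I c₀ C₀)
    (hb : CellPeriodic ε b) (hbm : AEStronglyMeasurable b (volume.restrict (cell ε)))
    (hbA : ∀ᵐ x ∂volume.restrict (cell ε), |b x| ≤ A) (w : H1Strip 0 (ε * L) (ε * K))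
    (hw : InSpan ε L K (blochSpan Ψ I) w.val) :
    c₀ * l2NormSq (box ε L K) w.val ≤
      s * (∫ x in box ε L K, conj (w.val x) * ((b x : ℂ) * w.d₁ x)).im := by
  obtain ⟨w', hw', hww'⟩ := hw
  rw [blochSpan, Finsupp.mem_span_image_iff_linearCombination] at hw'
  obtain ⟨α, hα, rfl⟩ := hw'
  have hsI : ∀ lam ∈ α.support, lam ∈ I := fun lam h => (Finsupp.mem_supported _ _).1 hα h
  have hwv : w.val =ᵐ[volume.restrict (box ε L K)]
      fun x => ∑ lam ∈ α.support, α lam * blochWave Ψ lam x := by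
    filter_upwards [hww'] with x hx
    rw [hx, Finsupp.linearCombination_apply, Finsupp.sum]
    simp
  have hwd := d₁_ae_eq_sum Ψ hε _ _ w hwv
  have hdist : ∀ lam ∈ α.support, ∀ mu ∈ α.support, lam ≠ mu → lam.1 ≠ mu.1 :=
    fun lam h mu h' => hI.wave_ne lam (hsI lam h) mu (hsI mu h')
  have hbq : CellPeriodic ε (fun x => (b x : ℂ)) :=
    ⟨fun x => congrArg _ (hb.1 x), fun x => congrArg _ (hb.2 x)⟩
  have h1 := integral_box_conj_sum_mul_sum hε α.support hdist α
    (quasiperiodic_blochWave Ψ · hε) (quasiperiodic_blochWave Ψ · hε)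
    (memLp_cell_blochWave Ψ) (memLp_cell_blochWave Ψ)
  -- The weight `b` is periodic, so multiplying by it leaves the translation factors, and hence the
  -- orthogonality, intact.
  have h2 := integral_box_conj_sum_mul_sum hε α.support hdist α
    (G := fun lam x => (b x : ℂ) * blochWaveD₁ Ψ lam x)
    (quasiperiodic_blochWave Ψ · hε)
    (fun lam => by simpa using hbq.quasiperiodic.mul (quasiperiodic_blochWaveD₁ Ψ lam hε))
    (memLp_cell_blochWave Ψ) (fun lam => ofReal_mul_memLp hbm hbA (memLp_cell_blochWaveD₁ Ψ lam))
  set v := volume.real (cell ε) with hv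
  have hv0 : 0 ≤ v := measureReal_nonneg
  have hn : ∀ lam, ∫ x in cell ε, conj (blochWave Ψ lam x) * blochWave Ψ lam x = (v : ℂ) := by
    intro lam
    have h := (hΨ lam.1).2 lam.2 lam.2
    rw [setAverage_eq, if_pos rfl] at h
    -- With a null cell every average would be 0, contradicting the normalization to 1.
    have hvne : v ≠ 0 := fun h0 => by simp [← hv, h0] at h
    have e : ∀ x, conj (blochWave Ψ lam x) * blochWave Ψ lam x =
        conj ((Ψ lam.1 lam.2).val x) * (Ψ lam.1 lam.2).val x := by
      intro x
      rw [Complex.conj_mul', Complex.conj_mul', blochWave, norm_mul, norm_phase, mul_one]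
    simp only [e]
    rw [← hv, Complex.real_smul] at h
    have hvc : (v : ℂ) ≠ 0 := by exact_mod_cast hvne
    push_cast at h
    field_simp at h
    exact h
  have hp : ∀ lam ∈ α.support, c₀ * v ≤
      s * (∫ x in cell ε, conj (blochWave Ψ lam x) * ((b x : ℂ) * blochWaveD₁ Ψ lam x)).im := by
    intro lam hlam
    have h := hI.speed lam (hsI lam hlam)
    have hvne : v ≠ 0 := by
      intro h0
      have h := (hΨ lam.1).2 lam.2 lam.2
      rw [setAverage_eq, if_pos rfl] at h
      simp [← hv, h0] at h
    rw [poynting, setAverage_eq, Complex.smul_im, ← hv, smul_eq_mul] at h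
    calc c₀ * v ≤ _ := mul_le_mul_of_nonneg_right h hv0
      _ = _ := by field_simp
  have hL : l2NormSq (box ε L K) w.val = ∑ lam ∈ α.support, ‖α lam‖ ^ 2 * (L * K) * v := by
    apply Complex.ofReal_injective
    rw [l2NormSq, ← integral_complex_ofReal]
    push_cast
    have : ∫ x in box ε L K, ((‖w.val x‖ : ℂ)) ^ 2 = ∫ x in box ε L K,
        conj (∑ lam ∈ α.support, α lam * blochWave Ψ lam x) *
          ∑ lam ∈ α.support, α lam * blochWave Ψ lam x := by
      refine integral_congr_ae ?_
      filter_upwards [hwv] with x hx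
      rw [hx, Complex.conj_mul']
    rw [this, h1]
    simp only [hn]
    push_cast
    rfl
  have hR : ∫ x in box ε L K, conj (w.val x) * ((b x : ℂ) * w.d₁ x) =
      ∑ lam ∈ α.support, ((‖α lam‖ ^ 2 * (L * K) : ℝ) : ℂ) *
        ∫ x in cell ε, conj (blochWave Ψ lam x) * ((b x : ℂ) * blochWaveD₁ Ψ lam x) := by
    rw [← h2]
    refine integral_congr_ae ?_
    filter_upwards [hwv, hwd] with x hx hx'
    rw [hx, hx', Finset.mul_sum]
    congr 1
    exact Finset.sum_congr rfl fun _ _ => by ring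
  rw [hL, hR, Complex.im_sum, Finset.mul_sum, Finset.mul_sum]
  refine Finset.sum_le_sum fun lam hlam => ?_
  rw [Complex.im_ofReal_mul]
  have := mul_le_mul_of_nonneg_left (hp lam hlam) (by positivity : 0 ≤ ‖α lam‖ ^ 2 * (L * K : ℝ))
  linarith

/-! ### Horizontal translation -/

/-- The horizontal translation by `c`. -/
def hshift (c : ℝ) (x : ℝ × ℝ) : ℝ × ℝ := (c + x.1, x.2)

theorem hshift_eq (c : ℝ) : hshift c = fun x => (c, 0) + x := by
  funext x; ext <;> simp [hshift]

theorem measurableEmbedding_hshift (c : ℝ) : MeasurableEmbedding (hshift c) := by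
  rw [hshift_eq]; exact measurableEmbedding_addLeft _

theorem measurePreserving_hshift (c s : ℝ) (B : Set ℝ) :
    MeasurePreserving (hshift c) (volume.restrict (Ioo 0 s ×ˢ B))
      (volume.restrict (Ioo c (c + s) ×ˢ B)) := by
  have h := (measurePreserving_add_left (volume : Measure (ℝ × ℝ)) ((c, 0) : ℝ × ℝ))
    |>.restrict_preimage_emb (measurableEmbedding_addLeft _) (Ioo c (c + s) ×ˢ B)
  rw [← hshift_eq] at h
  convert h using 2
  ext x
  simp [hshift]

theorem integral_hshift (c s : ℝ) (B : Set ℝ) {E : Type*} [NormedAddCommGroup E] [NormedSpace ℝ E]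
    (F : ℝ × ℝ → E) :
    ∫ x in Ioo 0 s ×ˢ B, F (hshift c x) = ∫ x in Ioo c (c + s) ×ˢ B, F x :=
  (measurePreserving_hshift c s B).integral_comp (measurableEmbedding_hshift c) F

theorem IsTest.comp_hshift_neg {c s : ℝ} {φ : ℝ × ℝ → ℂ} (hφ : IsTest (Ioo 0 s ×ˢ univ) φ) :
    IsTest (Ioo c (c + s) ×ˢ univ) (fun x => φ (x - (c, 0))) := by
  have e : (fun x => φ (x - ((c, 0) : ℝ × ℝ))) = φ ∘ Homeomorph.subRight ((c, 0) : ℝ × ℝ) := rfl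
  refine ⟨hφ.smooth.comp (contDiff_id.sub contDiff_const), ?_, ?_⟩
  · rw [e]; exact hφ.compact.comp_homeomorph _
  · rw [e, tsupport_comp_eq_preimage]
    intro x hx
    have := hφ.subset hx
    simp only [Homeomorph.subRight_apply, mem_prod, Prod.fst_sub, mem_Ioo, Prod.snd_sub] at this
    exact ⟨⟨by linarith [this.1.1], by linarith [this.1.2]⟩, mem_univ _⟩

theorem setIntegral_hshift_mul {l r c s : ℝ} (hl : l ≤ c) (hr : c + s ≤ r) (F ψ : ℝ × ℝ → ℂ)
    (hψ : Function.support (fun x => ψ (x - (c, 0))) ⊆ Ioo c (c + s) ×ˢ univ) :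
    ∫ x in Ioo 0 s ×ˢ univ, F (hshift c x) * ψ x =
      ∫ x in Ioo l r ×ˢ univ, F x * ψ (x - (c, 0)) := by
  rw [setIntegral_mul_eq_of_support_subset (measurableSet_Ioo.prod MeasurableSet.univ)
    (prod_mono_left (Ioo_subset_Ioo hl hr)) hψ,
    ← integral_hshift c s univ (fun x => F x * ψ (x - (c, 0)))]
  congr 1; funext x
  congr 2
  ext <;> simp [hshift]

/-- The restriction of an element of `H¹` to a smaller rectangle, translated to the origin. -/
def H1Strip.hshift {l r H : ℝ} (u : H1Strip l r H) (c s : ℝ) (hl : l ≤ c) (hr : c + s ≤ r) :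
    H1Strip 0 s H :=
  have mem : ∀ {F : ℝ × ℝ → ℂ}, MemLp F 2 (volume.restrict (rect l r H)) →
      MemLp (fun x => F (Waveguide.hshift c x)) 2 (volume.restrict (rect 0 s H)) := fun hF =>
    (hF.mono_measure (Measure.restrict_mono (prod_mono_left (Ioo_subset_Ioo hl hr)) le_rfl)
      ).comp_measurePreserving (measurePreserving_hshift c s (Ioo 0 H))
  have per : ∀ {F : ℝ × ℝ → ℂ}, Function.Periodic F ((0, H) : ℝ × ℝ) →
      Function.Periodic (fun x => F (Waveguide.hshift c x)) ((0, H) : ℝ × ℝ) := fun {F} hF x =>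
    (congrArg F (by ext <;> simp [Waveguide.hshift])).trans (hF (Waveguide.hshift c x))
  { val := fun x => u.val (Waveguide.hshift c x)
    d₁ := fun x => u.d₁ (Waveguide.hshift c x)
    d₂ := fun x => u.d₂ (Waveguide.hshift c x)
    periodic_val := per u.periodic_val
    periodic_d₁ := per u.periodic_d₁
    periodic_d₂ := per u.periodic_d₂
    memLp_val := mem u.memLp_val
    memLp_d₁ := mem u.memLp_d₁
    memLp_d₂ := mem u.memLp_d₂
    weakGrad := fun φ hφ => by
      have hφ' := hφ.comp_hshift_neg (c := c)
      have h := u.weakGrad _ (hφ'.mono (prod_mono_left (Ioo_subset_Ioo hl hr)))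
      have hd : ∀ v x : ℝ × ℝ, fderiv ℝ (fun x => φ (x - ((c, 0) : ℝ × ℝ))) x v =
          fderiv ℝ φ (x - (c, 0)) v := fun v x => by rw [fderiv_comp_sub]
      have hs : ∀ v : ℝ × ℝ, Function.support (fun x => fderiv ℝ φ (x - (c, 0)) v) ⊆
          Ioo c (c + s) ×ˢ univ := fun v => by
        simp only [← hd]; exact hφ'.support_fderiv_subset v
      simp only [hd] at h
      refine ⟨?_, ?_⟩
      · rw [setIntegral_hshift_mul hl hr u.val (fun x => fderiv ℝ φ x (1, 0)) (hs _),
          setIntegral_hshift_mul hl hr u.d₁ φ hφ'.support_subset]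
        exact h.1
      · rw [setIntegral_hshift_mul hl hr u.val (fun x => fderiv ℝ φ x (0, 1)) (hs _),
          setIntegral_hshift_mul hl hr u.d₂ φ hφ'.support_subset]
        exact h.2 }

theorem l2NormSq_hshift (c s H : ℝ) (F : ℝ × ℝ → ℂ) :
    l2NormSq (rect 0 s H) (fun x => F (hshift c x)) = l2NormSq (rect c (c + s) H) F :=
  integral_hshift c s (Ioo 0 H) (fun x => ‖F x‖ ^ 2)

/-! ### Estimates in the radiation boxes -/

/-- Flux and inverse estimates in a radiation box. -/
theorem radiation_box_estimates {ε : ℝ} (hε : 0 < ε) {L K : ℕ} (hL : 0 < L) (hK : 0 < K)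
    {l r c s c₀ C₀ A : ℝ} (hl : l ≤ c) (hr : c + ε * L ≤ r) {a b : ℝ × ℝ → ℝ}
    {Ψ : Fin L × Fin K → ℕ → H1Cell ε} {I : Set (BlochIndex L K)}
    (hΨ : ∀ k, IsBlochFamily ε b (waveVector k) (Ψ k)) (hI : IsAdmissible s b Ψ I c₀ C₀)
    (hb : CellPeriodic ε b)
    (ham : AEStronglyMeasurable a (volume.restrict (rect c (c + ε * L) (ε * K))))
    (haA : ∀ᵐ x ∂volume.restrict (rect c (c + ε * L) (ε * K)), |a x| ≤ A)
    (hab : ∀ᵐ x ∂volume.restrict (rect c (c + ε * L) (ε * K)), a x = b x)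
    (hbs : ∀ x, b (hshift c x) = b x) (u : H1Strip l r (ε * K))
    (hu : InSpan ε L K (blochSpan Ψ I) (fun x => u.val (hshift c x))) :
    c₀ * l2NormSq (rect c (c + ε * L) (ε * K)) u.val ≤
        -(s * (∫ x in rect c (c + ε * L) (ε * K), (a x : ℂ) * conj (u.d₁ x) * u.val x).im) ∧
      l2NormSq (rect c (c + ε * L) (ε * K)) u.val + l2NormSq (rect c (c + ε * L) (ε * K)) u.d₁
        + l2NormSq (rect c (c + ε * L) (ε * K)) u.d₂ ≤
        C₀ * l2NormSq (rect c (c + ε * L) (ε * K)) u.val := by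
  set w := u.hshift c (ε * L) hl hr with hw
  have hmp : MeasurePreserving (hshift c) (volume.restrict (box ε L K))
    (volume.restrict (rect c (c + ε * L) (ε * K))) := measurePreserving_hshift c (ε * L) _
  have hab' : ∀ᵐ x ∂volume.restrict (box ε L K), a (hshift c x) = b x := by
    filter_upwards [hmp.quasiMeasurePreserving.ae hab] with x hx
    rw [hx, hbs]
  have hcell : cell ε ⊆ box ε L K := by
    have h1 : (1 : ℝ) ≤ L := by exact_mod_cast hL
    have h2 : (1 : ℝ) ≤ K := by exact_mod_cast hK
    exact prod_mono (Ioo_subset_Ioo le_rfl (by nlinarith)) (Ioo_subset_Ioo le_rfl (by nlinarith))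
  have hle : volume.restrict (cell ε) ≤ volume.restrict (box ε L K) :=
    Measure.restrict_mono hcell le_rfl
  have hbm : AEStronglyMeasurable b (volume.restrict (box ε L K)) :=
    (ham.comp_quasiMeasurePreserving hmp.quasiMeasurePreserving).congr hab'
  have hbA : ∀ᵐ x ∂volume.restrict (box ε L K), |b x| ≤ A := by
    filter_upwards [hmp.quasiMeasurePreserving.ae haA, hab'] with x hx hx'
    rwa [← hx']
  have e0 : l2NormSq (box ε L K) w.val = l2NormSq (rect c (c + ε * L) (ε * K)) u.val :=
    l2NormSq_hshift c _ _ u.val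
  have e1 : l2NormSq (rect 0 (ε * L) (ε * K)) w.d₁ = l2NormSq (rect c (c + ε * L) (ε * K)) u.d₁ :=
    l2NormSq_hshift c _ _ u.d₁
  have e2 : l2NormSq (rect 0 (ε * L) (ε * K)) w.d₂ = l2NormSq (rect c (c + ε * L) (ε * K)) u.d₂ :=
    l2NormSq_hshift c _ _ u.d₂
  refine ⟨?_, ?_⟩
  · have h := flux_lower_bound hε hΨ hI hb (hbm.mono_measure hle) (ae_mono hle hbA) w hu
    rw [e0] at h
    refine h.trans_eq ?_
    rw [← mul_neg]
    congr 1
    have h3 : ∫ x in box ε L K, conj (w.val x) * ((b x : ℂ) * w.d₁ x) =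
        ∫ x in rect c (c + ε * L) (ε * K), conj (u.val x) * ((a x : ℂ) * u.d₁ x) := by
      have h4 := integral_hshift c (ε * L) (Ioo 0 (ε * K))
        (fun x => conj (u.val x) * ((a x : ℂ) * u.d₁ x))
      rw [rect, ← h4]
      refine integral_congr_ae ?_
      filter_upwards [hab'] with x hx
      simp only [hx]
      rfl
    -- The Poynting number conjugates the wave, whereas β conjugates the derivative. The two
    -- integrals are complex conjugates, which is the source of the minus sign in the flux estimate.
    have h5 : ∫ x in rect c (c + ε * L) (ε * K), conj (u.val x) * ((a x : ℂ) * u.d₁ x) =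
        conj (∫ x in rect c (c + ε * L) (ε * K), (a x : ℂ) * conj (u.d₁ x) * u.val x) := by
      rw [← integral_conj]
      congr 1; funext x
      simp only [map_mul, Complex.conj_ofReal, Complex.conj_conj]
      ring
    rw [h3, h5, Complex.conj_im]
  · have h := hI.inverse w hu
    rw [H1Strip.h1NormSq, e1, e2, e0] at h
    have e0' : l2NormSq (rect 0 (ε * L) (ε * K)) w.val =
      l2NormSq (rect c (c + ε * L) (ε * K)) u.val := e0
    rwa [e0'] at h

/-! ### The cut-off function and the decomposition of the truncated domain -/

section Cutoff

variable {ε : ℝ} {R L : ℕ}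

theorem cutoff_nonneg (hε : 0 < ε) (ξ : ℝ) : 0 ≤ cutoff ε R L ξ := by
  unfold cutoff
  split_ifs with h1 h2
  · exact le_rfl
  · exact zero_le_one
  · exact div_nonneg (by linarith) (by positivity)

theorem cutoff_le_one (hε : 0 < ε) (hL : 0 < L) (ξ : ℝ) : cutoff ε R L ξ ≤ 1 := by
  have hL' : (0 : ℝ) < L := by exact_mod_cast hL
  unfold cutoff
  split_ifs with h1 h2
  · exact zero_le_one
  · exact le_rfl
  · rw [div_le_one (by positivity)]
    push_cast
    linarith

theorem cutoff_eq_one (hε : 0 < ε) (hL : 0 < L) {ξ : ℝ} (h : |ξ| ≤ ε * R) :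
    cutoff ε R L ξ = 1 := by
  have hL' : (0 : ℝ) < L := by exact_mod_cast hL
  rw [cutoff, if_neg, if_pos h]
  push_cast
  nlinarith

theorem measurable_cutoff : Measurable (cutoff ε R L) := by
  unfold cutoff
  refine Measurable.ite (measurableSet_le measurable_const measurable_norm) measurable_const
    (Measurable.ite (measurableSet_le measurable_norm measurable_const) measurable_const ?_)
  exact (measurable_const.sub measurable_norm).div_const _

end Cutoff

theorem restrict_rect_split {l m r : ℝ} (H : ℝ) (h₁ : l ≤ m) (h₂ : m ≤ r) :
    volume.restrict (rect l r H) = volume.restrict (rect l m H) + volume.restrict (rect m r H) := by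
  have e : ∀ c d : ℝ, (rect c d H : Set (ℝ × ℝ)) =ᵐ[volume] (Ioc c d ×ˢ Ioo 0 H : Set (ℝ × ℝ)) :=
    fun c d => Measure.set_prod_ae_eq Ioo_ae_eq_Ioc (Filter.EventuallyEq.refl _ _)
  rw [Measure.restrict_congr_set (e l r), Measure.restrict_congr_set (e l m),
    Measure.restrict_congr_set (e m r), ← Ioc_union_Ioc_eq_Ioc h₁ h₂, union_prod,
    Measure.restrict_union _ (measurableSet_Ioc.prod measurableSet_Ioo)]
  exact Disjoint.set_prod_left (Ioc_disjoint_Ioc_of_le le_rfl) _ _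

theorem restrict_trunc_eq {ε : ℝ} (hε : 0 < ε) (K R L : ℕ) :
    volume.restrict (trunc ε K (R + L)) = volume.restrict (boxLeft ε K R L) +
      (volume.restrict (trunc ε K R) + volume.restrict (boxRight ε K R L)) := by
  have h0 : 0 ≤ ε * R := by positivity
  have h1 : ε * R ≤ ε * (R + L : ℕ) := by gcongr; simp
  rw [trunc, restrict_rect_split (m := -(ε * R)) _ (by linarith) (by linarith),
    restrict_rect_split (l := -(ε * R)) (m := ε * R) _ (by linarith) h1]
  rfl

theorem trunc_subset {ε : ℝ} (hε : 0 < ε) (K R L : ℕ) : trunc ε K R ⊆ trunc ε K (R + L) := by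
  have h1 : ε * R ≤ ε * (R + L : ℕ) := by gcongr; simp
  exact prod_mono_left (Ioo_subset_Ioo (by linarith) h1)

theorem boxRight_subset {ε : ℝ} (hε : 0 < ε) (K R L : ℕ) :
    boxRight ε K R L ⊆ trunc ε K (R + L) := by
  have h0 : 0 ≤ ε * R := by positivity
  have h1 : ε * R ≤ ε * (R + L : ℕ) := by gcongr; simp
  exact prod_mono_left (Ioo_subset_Ioo (by linarith) le_rfl)

theorem boxLeft_subset {ε : ℝ} (hε : 0 < ε) (K R L : ℕ) :
    boxLeft ε K R L ⊆ trunc ε K (R + L) := by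
  have h0 : 0 ≤ ε * R := by positivity
  have h1 : ε * R ≤ ε * (R + L : ℕ) := by gcongr; simp
  exact prod_mono_left (Ioo_subset_Ioo le_rfl (by linarith))

theorem boxRight_eq (ε : ℝ) (K R L : ℕ) :
    boxRight ε K R L = rect (ε * R) (ε * R + ε * L) (ε * K) := by
  rw [boxRight]; push_cast; rw [mul_add]

theorem boxLeft_eq (ε : ℝ) (K R L : ℕ) :
    boxLeft ε K R L = rect (-(ε * (R + L : ℕ))) (-(ε * (R + L : ℕ)) + ε * L) (ε * K) := by
  rw [boxLeft]
  congr 1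
  push_cast
  ring

theorem trunc_subset_strip (ε : ℝ) (K S : ℕ) : trunc ε K S ⊆ strip ε K :=
  prod_mono_left (subset_univ _)

theorem measurableSet_trunc (ε : ℝ) (K S : ℕ) : MeasurableSet (trunc ε K S) :=
  measurableSet_rect _ _ _

theorem integrable_norm_sq {F : ℝ × ℝ → ℂ} {μ : Measure (ℝ × ℝ)} (hF : MemLp F 2 μ) :
    Integrable (fun x => ‖F x‖ ^ 2) μ :=
  (memLp_two_iff_integrable_sq_norm hF.1).1 hF

theorem l2NormSq_nonneg (D : Set (ℝ × ℝ)) (F : ℝ × ℝ → ℂ) : 0 ≤ l2NormSq D F :=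
  integral_nonneg fun _ => by positivity

theorem l2NormSq_trunc_eq {ε : ℝ} (hε : 0 < ε) (K R L : ℕ) {F : ℝ × ℝ → ℂ}
    (hF : MemLp F 2 (volume.restrict (trunc ε K (R + L)))) :
    l2NormSq (trunc ε K (R + L)) F = l2NormSq (boxLeft ε K R L) F +
      (l2NormSq (trunc ε K R) F + l2NormSq (boxRight ε K R L) F) := by
  have h := integrable_norm_sq hF
  rw [restrict_trunc_eq hε, integrable_add_measure, integrable_add_measure] at h
  rw [l2NormSq, restrict_trunc_eq hε, integral_add_measure h.1 (h.2.1.add_measure h.2.2),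
    integral_add_measure h.2.1 h.2.2]
  rfl

/-! ### Coercivity -/

/-- Young's inequality. It leaves a sum of squared norms, the form in which the inverse estimate can
be applied. -/
theorem norm_integral_le_half {D : Set (ℝ × ℝ)} {A : ℝ} {a : ℝ × ℝ → ℝ} {F G : ℝ × ℝ → ℂ}
    (haA : ∀ᵐ x ∂volume.restrict D, |a x| ≤ A) (hF : MemLp F 2 (volume.restrict D))
    (hG : MemLp G 2 (volume.restrict D)) :
    ‖∫ x in D, (a x : ℂ) * conj (F x) * G x‖ ≤ A / 2 * (l2NormSq D F + l2NormSq D G) := by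
  rw [l2NormSq, l2NormSq, ← integral_add (integrable_norm_sq hF) (integrable_norm_sq hG),
    ← integral_const_mul]
  refine norm_integral_le_of_norm_le
    (((integrable_norm_sq hF).add (integrable_norm_sq hG)).const_mul _) ?_
  filter_upwards [haA] with x hx
  rw [norm_mul, norm_mul, Complex.norm_real, RCLike.norm_conj, Real.norm_eq_abs]
  have h0 := abs_nonneg (a x)
  have h1 : |a x| * (‖F x‖ * ‖G x‖) ≤ A * ((‖F x‖ ^ 2 + ‖G x‖ ^ 2) / 2) :=
    mul_le_mul hx (by nlinarith [sq_nonneg (‖F x‖ - ‖G x‖)]) (by positivity) (h0.trans hx)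
  linarith

section Coercive

variable {ε ω δ a₀ a₁ c₀ C₀ : ℝ} {K R L : ℕ} {a aP aM : ℝ × ℝ → ℝ}

theorem IsMedium.ae_abs_le (ha₀ : 0 < a₀) (h : IsMedium ε K R a₀ a₁ a aP aM) :
    ∀ᵐ x ∂volume.restrict (strip ε K), |a x| ≤ |a₁| := by
  filter_upwards [h.lower, h.upper] with x h1 h2
  rw [abs_of_pos (ha₀.trans_le h1)]
  exact h2.trans (le_abs_self _)

theorem CellPeriodic.nat_mul {α : Type*} {b : ℝ × ℝ → α} (hb : CellPeriodic ε b) (n : ℕ) :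
    Function.Periodic b ((ε * n, 0) : ℝ × ℝ) := by
  have := hb.1.nsmul n
  simpa [mul_comm] using this

/-- Since `R > 0`, the box lies in the region x₁ > εR/2, where `a` is the periodic coefficient, and
the shift by εR is a whole number of periods. The estimates on the reference box therefore carry
over. -/
theorem right_box_estimates (hε : 0 < ε) (ha₀ : 0 < a₀) (hK : 0 < K) (hR : 0 < R) (hL : 0 < L)
    {Ψ : Fin L × Fin K → ℕ → H1Cell ε} {I : Set (BlochIndex L K)}
    (hmed : IsMedium ε K R a₀ a₁ a aP aM) (hΨ : ∀ k, IsBlochFamily ε aP (waveVector k) (Ψ k))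
    (hI : IsAdmissible 1 aP Ψ I c₀ C₀) (u : H1Trunc ε K (R + L))
    (hu : InSpan ε L K (blochSpan Ψ I) (restrictRight ε R u.val)) :
    c₀ * l2NormSq (boxRight ε K R L) u.val ≤
        -(∫ x in boxRight ε K R L, (a x : ℂ) * conj (u.d₁ x) * u.val x).im ∧
      l2NormSq (boxRight ε K R L) u.val + l2NormSq (boxRight ε K R L) u.d₁
        + l2NormSq (boxRight ε K R L) u.d₂ ≤ C₀ * l2NormSq (boxRight ε K R L) u.val := by
  have hsub : boxRight ε K R L ⊆ strip ε K :=
    (boxRight_subset hε K R L).trans (trunc_subset_strip _ _ _)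
  have hle : volume.restrict (boxRight ε K R L) ≤ volume.restrict (strip ε K) :=
    Measure.restrict_mono hsub le_rfl
  have hR' : (0 : ℝ) < ε * R := by positivity
  have hab : ∀ᵐ x ∂volume.restrict (boxRight ε K R L), a x = aP x := by
    filter_upwards [ae_mono hle hmed.eqP, ae_restrict_mem (measurableSet_rect _ _ _)] with x hx hx'
    exact hx (by have := hx'.1.1; linarith)
  have h := radiation_box_estimates (a := a) (A := |a₁|) hε hL hK (l := -(ε * (R + L : ℕ)))
    (r := ε * (R + L : ℕ)) (c := ε * R) (by push_cast; nlinarith) (by push_cast; linarith) hΨ hI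
    hmed.periodicP (by rw [← boxRight_eq]; exact hmed.measurable.mono_measure hle)
    (by rw [← boxRight_eq]; exact ae_mono hle (hmed.ae_abs_le ha₀))
    (by rw [← boxRight_eq]; exact hab)
    (fun x => by
      rw [← hmed.periodicP.nat_mul R x, hshift_eq, add_comm x]) u hu
  rw [one_mul, ← boxRight_eq] at h
  exact h

theorem left_box_estimates (hε : 0 < ε) (ha₀ : 0 < a₀) (hK : 0 < K) (hR : 0 < R) (hL : 0 < L)
    {Ψ : Fin L × Fin K → ℕ → H1Cell ε} {I : Set (BlochIndex L K)}
    (hmed : IsMedium ε K R a₀ a₁ a aP aM) (hΨ : ∀ k, IsBlochFamily ε aM (waveVector k) (Ψ k))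
    (hI : IsAdmissible (-1) aM Ψ I c₀ C₀) (u : H1Trunc ε K (R + L))
    (hu : InSpan ε L K (blochSpan Ψ I) (restrictLeft ε R L u.val)) :
    c₀ * l2NormSq (boxLeft ε K R L) u.val ≤
        (∫ x in boxLeft ε K R L, (a x : ℂ) * conj (u.d₁ x) * u.val x).im ∧
      l2NormSq (boxLeft ε K R L) u.val + l2NormSq (boxLeft ε K R L) u.d₁
        + l2NormSq (boxLeft ε K R L) u.d₂ ≤ C₀ * l2NormSq (boxLeft ε K R L) u.val := by
  have hsub : boxLeft ε K R L ⊆ strip ε K :=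
    (boxLeft_subset hε K R L).trans (trunc_subset_strip _ _ _)
  have hle : volume.restrict (boxLeft ε K R L) ≤ volume.restrict (strip ε K) :=
    Measure.restrict_mono hsub le_rfl
  have hR' : (0 : ℝ) < ε * R := by positivity
  have hab : ∀ᵐ x ∂volume.restrict (boxLeft ε K R L), a x = aM x := by
    filter_upwards [ae_mono hle hmed.eqM, ae_restrict_mem (measurableSet_rect _ _ _)] with x hx hx'
    exact hx (by have := hx'.1.2; linarith)
  have h := radiation_box_estimates (a := a) (A := |a₁|) hε hL hK (l := -(ε * (R + L : ℕ)))
    (r := ε * (R + L : ℕ)) (c := -(ε * (R + L : ℕ))) le_rfl (by push_cast; nlinarith) hΨ hI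
    hmed.periodicM (by rw [← boxLeft_eq]; exact hmed.measurable.mono_measure hle)
    (by rw [← boxLeft_eq]; exact ae_mono hle (hmed.ae_abs_le ha₀))
    (by rw [← boxLeft_eq]; exact hab)
    (fun x => by
      rw [← hmed.periodicM.nat_mul (R + L) (hshift _ x)]
      congr 1
      ext <;> simp [hshift]) u hu
  rw [← boxLeft_eq, neg_one_mul, neg_neg] at h
  exact h

/-- `T` and `N` are the weighted gradient and mass integrals. The gradient part outside Ω_R is
nonnegative and is discarded in the bound on `T`, because ϑ gives no uniform lower bound there. -/
theorem beta_self (hε : 0 < ε) (ha₀ : 0 < a₀) (hL : 0 < L)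
    (hmed : IsMedium ε K R a₀ a₁ a aP aM) (u : H1Trunc ε K (R + L)) :
    ∃ T N : ℝ, a₀ * (l2NormSq (trunc ε K R) u.d₁ + l2NormSq (trunc ε K R) u.d₂) ≤ T ∧
      N ≤ l2NormSq (trunc ε K (R + L)) u.val ∧
      beta ω δ a u u = (T : ℂ) - (ω ^ 2 * N : ℝ)
        + (δ * ω ^ 2 * l2NormSq (trunc ε K R) u.val : ℝ) * Complex.I
        - ((1 / (ε * L) : ℝ) : ℂ) *
          (∫ x in boxRight ε K R L, (a x : ℂ) * conj (u.d₁ x) * u.val x)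
        + ((1 / (ε * L) : ℝ) : ℂ) *
          (∫ x in boxLeft ε K R L, (a x : ℂ) * conj (u.d₁ x) * u.val x) := by
  have hle : volume.restrict (trunc ε K (R + L)) ≤ volume.restrict (strip ε K) :=
    Measure.restrict_mono (trunc_subset_strip _ _ _) le_rfl
  have hle' : volume.restrict (trunc ε K R) ≤ volume.restrict (trunc ε K (R + L)) :=
    Measure.restrict_mono (trunc_subset hε K R L) le_rfl
  have hlow := ae_mono hle hmed.lower
  have habs := ae_mono hle (hmed.ae_abs_le ha₀)
  have i0 := integrable_norm_sq u.memLp_val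
  have i1 := integrable_norm_sq u.memLp_d₁
  have i2 := integrable_norm_sq u.memLp_d₂
  have hone : ∀ x ∈ trunc ε K R, cutoff ε R L x.1 = 1 := fun x hx =>
    cutoff_eq_one hε hL (abs_le.2 ⟨hx.1.1.le, hx.1.2.le⟩)
  have hcm : AEStronglyMeasurable (fun x : ℝ × ℝ => cutoff ε R L x.1)
      (volume.restrict (trunc ε K (R + L))) :=
    (measurable_cutoff.comp measurable_fst).aestronglyMeasurable
  have hc1 : ∀ x : ℝ × ℝ, ‖cutoff ε R L x.1‖ ≤ 1 := fun x => by
    rw [Real.norm_eq_abs, abs_of_nonneg (cutoff_nonneg hε _)]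
    exact cutoff_le_one hε hL _
  have iT : IntegrableOn (fun x => a x * (‖u.d₁ x‖ ^ 2 + ‖u.d₂ x‖ ^ 2) * cutoff ε R L x.1)
      (trunc ε K (R + L)) :=
    ((i1.add i2).bdd_mul (hmed.measurable.mono_measure hle) habs).mul_bdd hcm (ae_of_all _ hc1)
  have iN : IntegrableOn (fun x => ‖u.val x‖ ^ 2 * cutoff ε R L x.1) (trunc ε K (R + L)) :=
    i0.mul_bdd hcm (ae_of_all _ hc1)
  refine ⟨∫ x in trunc ε K (R + L), a x * (‖u.d₁ x‖ ^ 2 + ‖u.d₂ x‖ ^ 2) * cutoff ε R L x.1,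
    ∫ x in trunc ε K (R + L), ‖u.val x‖ ^ 2 * cutoff ε R L x.1, ?_, ?_, ?_⟩
  · calc a₀ * (l2NormSq (trunc ε K R) u.d₁ + l2NormSq (trunc ε K R) u.d₂)
        = ∫ x in trunc ε K R, a₀ * (‖u.d₁ x‖ ^ 2 + ‖u.d₂ x‖ ^ 2) := by
          rw [integral_const_mul, integral_add (i1.mono_measure hle') (i2.mono_measure hle')]
          rfl
      _ ≤ ∫ x in trunc ε K R, a x * (‖u.d₁ x‖ ^ 2 + ‖u.d₂ x‖ ^ 2) * cutoff ε R L x.1 := by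
          refine integral_mono_ae (((i1.add i2).mono_measure hle').const_mul _)
            (Integrable.mono_measure iT hle') ?_
          filter_upwards [ae_mono hle' hlow, ae_restrict_mem (measurableSet_trunc ε K R)]
            with x hx hx'
          rw [hone x hx', mul_one]
          exact mul_le_mul_of_nonneg_right hx (by positivity)
      _ ≤ _ := by
          refine setIntegral_mono_set iT ?_ (trunc_subset hε K R L).eventuallyLE
          filter_upwards [hlow] with x hx
          exact mul_nonneg (mul_nonneg (ha₀.le.trans hx) (by positivity)) (cutoff_nonneg hε _)
  · refine integral_mono iN i0 fun x => ?_
    exact mul_le_of_le_one_right (by positivity) (cutoff_le_one hε hL _)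
  · have e1 : ∫ x in trunc ε K (R + L), (a x : ℂ) * (conj (u.d₁ x) * u.d₁ x
          + conj (u.d₂ x) * u.d₂ x) * (cutoff ε R L x.1 : ℂ) =
        ((∫ x in trunc ε K (R + L),
          a x * (‖u.d₁ x‖ ^ 2 + ‖u.d₂ x‖ ^ 2) * cutoff ε R L x.1 : ℝ) : ℂ) := by
      rw [← integral_complex_ofReal]
      congr 1; funext x
      rw [Complex.conj_mul', Complex.conj_mul']
      push_cast; rfl
    have i3 : IntegrableOn ((trunc ε K R).indicator fun x => ‖u.val x‖ ^ 2)
        (trunc ε K (R + L)) := i0.indicator (measurableSet_trunc _ _ _)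
    -- The cut-off is 1 on the absorbing region, so the absorption carries no weight. Its factor -iδ
    -- changes sign when this integral is subtracted in β.
    have e2 : ∫ x in trunc ε K (R + L),
          (1 - Complex.I * δ * (trunc ε K R).indicator (fun _ => (1 : ℂ)) x) * (ω : ℂ) ^ 2
            * conj (u.val x) * u.val x * (cutoff ε R L x.1 : ℂ) =
        ((ω ^ 2 * ∫ x in trunc ε K (R + L), ‖u.val x‖ ^ 2 * cutoff ε R L x.1 : ℝ) : ℂ) -
          (δ * ω ^ 2 * l2NormSq (trunc ε K R) u.val : ℝ) * Complex.I := by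
      have e3 : l2NormSq (trunc ε K R) u.val = ∫ x in trunc ε K (R + L),
          (trunc ε K R).indicator (fun x => ‖u.val x‖ ^ 2) x := by
        rw [setIntegral_indicator (measurableSet_trunc _ _ _),
          inter_eq_right.2 (trunc_subset hε K R L)]
        rfl
      rw [e3, Complex.ofReal_mul, Complex.ofReal_mul, ← integral_complex_ofReal,
        ← integral_complex_ofReal, mul_right_comm _ _ Complex.I, ← integral_const_mul,
        ← integral_const_mul, ← integral_sub (iN.ofReal.const_mul _) (i3.ofReal.const_mul _)]
      congr 1; funext x
      rw [mul_assoc _ (conj (u.val x)), Complex.conj_mul']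
      by_cases hx : x ∈ trunc ε K R
      · rw [indicator_of_mem hx, indicator_of_mem hx, hone x hx]
        push_cast; ring
      · rw [indicator_of_notMem hx, indicator_of_notMem hx]
        push_cast; ring
    rw [beta, e1, e2]
    push_cast
    ring

/-- Im β dominates γ times the squared L² norm on the whole domain. The three summands of `hMγ` pay,
in order, for the term -ω²‖u‖², for the real parts of the flux integrals, and for the missing parts
of the H¹ norm: the mass in Ω_R and everything in the boxes. -/
theorem beta_coercive (hε : 0 < ε) (ha₀ : 0 < a₀) (hC₀ : 0 < C₀)
    (hK : 0 < K) (hR : 0 < R) (hL : 0 < L)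
    {ΨP ΨM : Fin L × Fin K → ℕ → H1Cell ε} {IP IM : Set (BlochIndex L K)}
    (hmed : IsMedium ε K R a₀ a₁ a aP aM)
    (hΨP : ∀ k, IsBlochFamily ε aP (waveVector k) (ΨP k))
    (hΨM : ∀ k, IsBlochFamily ε aM (waveVector k) (ΨM k))
    (hIP : IsAdmissible 1 aP ΨP IP c₀ C₀) (hIM : IsAdmissible (-1) aM ΨM IM c₀ C₀)
    {M γ : ℝ} (hM : 0 ≤ M) (hγ₁ : γ ≤ δ * ω ^ 2) (hγ₂ : γ ≤ 1 / (ε * L) * c₀)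
    (hMγ : ω ^ 2 + 1 / (ε * L) * (|a₁| / 2 * C₀) + a₀ * (C₀ + 1) ≤ M * γ)
    (u : H1Trunc ε K (R + L)) (hu : MemV (blochSpan ΨP IP) (blochSpan ΨM IM) u) :
    a₀ * u.h1NormSq ≤ (beta ω δ a u u).re + M * (beta ω δ a u u).im := by
  obtain ⟨T, N, hT, hN, hβ⟩ := beta_self (ω := ω) (δ := δ) hε ha₀ hL hmed u
  obtain ⟨fp, gp⟩ := right_box_estimates hε ha₀ hK hR hL hmed hΨP hIP u hu.1
  obtain ⟨fm, gm⟩ := left_box_estimates hε ha₀ hK hR hL hmed hΨM hIM u hu.2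
  have hle : volume.restrict (trunc ε K (R + L)) ≤ volume.restrict (strip ε K) :=
    Measure.restrict_mono (trunc_subset_strip _ _ _) le_rfl
  have hlp : volume.restrict (boxRight ε K R L) ≤ volume.restrict (trunc ε K (R + L)) :=
    Measure.restrict_mono (boxRight_subset hε K R L) le_rfl
  have hlm : volume.restrict (boxLeft ε K R L) ≤ volume.restrict (trunc ε K (R + L)) :=
    Measure.restrict_mono (boxLeft_subset hε K R L) le_rfl
  have habs := ae_mono hle (hmed.ae_abs_le ha₀)
  have bp := norm_integral_le_half (ae_mono hlp habs) (u.memLp_d₁.mono_measure hlp)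
    (u.memLp_val.mono_measure hlp)
  have bm := norm_integral_le_half (ae_mono hlm habs) (u.memLp_d₁.mono_measure hlm)
    (u.memLp_val.mono_measure hlm)
  have hh : u.h1NormSq = l2NormSq (trunc ε K (R + L)) u.val + l2NormSq (trunc ε K (R + L)) u.d₁ +
    l2NormSq (trunc ε K (R + L)) u.d₂ := rfl
  rw [l2NormSq_trunc_eq hε K R L u.memLp_val, l2NormSq_trunc_eq hε K R L u.memLp_d₁,
    l2NormSq_trunc_eq hε K R L u.memLp_d₂] at hh
  rw [l2NormSq_trunc_eq hε K R L u.memLp_val] at hN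
  set Tp := ∫ x in boxRight ε K R L, (a x : ℂ) * conj (u.d₁ x) * u.val x
  set Tm := ∫ x in boxLeft ε K R L, (a x : ℂ) * conj (u.d₁ x) * u.val x
  have hd : 0 < 1 / (ε * L) := by positivity
  set d := 1 / (ε * L)
  have hre : (beta ω δ a u u).re = T - ω ^ 2 * N - d * Tp.re + d * Tm.re := by
    rw [hβ]
    simp [-Complex.ofReal_mul, -Complex.ofReal_pow]
  have him : (beta ω δ a u u).im = δ * ω ^ 2 * l2NormSq (trunc ε K R) u.val - d * Tp.im
      + d * Tm.im := by
    rw [hβ]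
    simp [-Complex.ofReal_mul, -Complex.ofReal_pow]
  rw [hh, hre, him]
  have nR := l2NormSq_nonneg (trunc ε K R) u.val
  have np := l2NormSq_nonneg (boxRight ε K R L) u.val
  have nm := l2NormSq_nonneg (boxLeft ε K R L) u.val
  have qp := l2NormSq_nonneg (boxRight ε K R L) u.d₂
  have qm := l2NormSq_nonneg (boxLeft ε K R L) u.d₂
  have rp := (Complex.abs_re_le_norm Tp).trans bp
  have rm := (Complex.abs_re_le_norm Tm).trans bm
  generalize l2NormSq (trunc ε K R) u.val = NR at *
  generalize l2NormSq (boxRight ε K R L) u.val = Np at *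
  generalize l2NormSq (boxLeft ε K R L) u.val = Nm at *
  generalize l2NormSq (trunc ε K R) u.d₁ = G1 at *
  generalize l2NormSq (trunc ε K R) u.d₂ = G2 at *
  generalize l2NormSq (boxRight ε K R L) u.d₁ = P1 at *
  generalize l2NormSq (boxRight ε K R L) u.d₂ = P2 at *
  generalize l2NormSq (boxLeft ε K R L) u.d₁ = M1 at *
  generalize l2NormSq (boxLeft ε K R L) u.d₂ = M2 at *
  have hA : 0 ≤ |a₁| / 2 := by positivity
  have rp' : Tp.re ≤ |a₁| / 2 * C₀ * Np := by
    refine (le_abs_self _).trans (rp.trans ?_)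
    rw [mul_assoc]; exact mul_le_mul_of_nonneg_left (by linarith) hA
  have rm' : -Tm.re ≤ |a₁| / 2 * C₀ * Nm := by
    refine (neg_le_abs _).trans (rm.trans ?_)
    rw [mul_assoc]; exact mul_le_mul_of_nonneg_left (by linarith) hA
  -- Absorption supplies the estimate in Ω_R and the two fluxes supply it in the boxes; γ is below
  -- both constants.
  have im_le : γ * (NR + Np + Nm) ≤ δ * ω ^ 2 * NR - d * Tp.im + d * Tm.im := by
    have k1 := mul_le_mul_of_nonneg_right hγ₁ nR
    have k2 := mul_le_mul_of_nonneg_right hγ₂ np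
    have k3 := mul_le_mul_of_nonneg_right hγ₂ nm
    have k4 := mul_le_mul_of_nonneg_left fp hd.le
    have k5 := mul_le_mul_of_nonneg_left fm hd.le
    linarith
  have k1 := mul_le_mul_of_nonneg_left im_le hM
  have k2 := mul_le_mul_of_nonneg_right hMγ (by positivity : 0 ≤ NR + Np + Nm)
  have k3 := mul_le_mul_of_nonneg_left hN (sq_nonneg ω)
  have k4 := mul_le_mul_of_nonneg_left rp' hd.le
  have k5 := mul_le_mul_of_nonneg_left rm' hd.le
  have k6 := mul_le_mul_of_nonneg_left gp ha₀.le
  have k7 := mul_le_mul_of_nonneg_left gm ha₀.le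
  have k8 : 0 ≤ a₀ * C₀ * NR := by positivity
  have k9 : 0 ≤ d * (|a₁| / 2 * C₀) * NR := by positivity
  have k10 : 0 ≤ a₀ * Np := by positivity
  have k11 : 0 ≤ a₀ * Nm := by positivity
  linarith

end Coercive

/-! ### The complex Lax-Milgram theorem -/

/-- The hypothesis implies c‖u‖² ≤ (1 + M)|B(u,u)|. The Riesz operator of `B` is thus bounded below,
hence injective with closed range, and the same bound forces the orthogonal complement of the range
to be trivial. -/
theorem lax_milgram {E : Type*} [NormedAddCommGroup E] [InnerProductSpace ℂ E] [CompleteSpace E]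
    (B : E →L⋆[ℂ] E →L[ℂ] ℂ) {c M : ℝ} (hc : 0 < c) (hM : 0 ≤ M)
    (h : ∀ u, c * ‖u‖ ^ 2 ≤ (B u u).re + M * (B u u).im) (F : E →L[ℂ] ℂ) :
    ∃ u, (∀ v, B u v = F v) ∧ (∀ u', (∀ v, B u' v = F v) → u' = u) ∧
      ‖u‖ ≤ (1 + M) / c * ‖F‖ := by
  have hn : ∀ u, c * ‖u‖ ^ 2 ≤ (1 + M) * ‖B u u‖ := fun u => by
    have h1 := Complex.re_le_norm (B u u)
    have h2 := mul_le_mul_of_nonneg_left ((le_abs_self _).trans (Complex.abs_im_le_norm (B u u))) hM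
    linarith [h u]
  have hcM : 0 ≤ (1 + M) / c := by positivity
  set T := InnerProductSpace.continuousLinearMapOfBilin B with hT
  have hTB : ∀ v w, inner ℂ (T v) w = B v w :=
    InnerProductSpace.continuousLinearMapOfBilin_apply B
  have bound : ∀ u, ‖u‖ ≤ (1 + M) / c * ‖T u‖ := fun u => by
    rcases eq_or_ne u 0 with rfl | hu
    · simp
    · have hu' : 0 < ‖u‖ := norm_pos_iff.2 hu
      have h1 := hn u
      rw [← hTB] at h1
      have h2 := norm_inner_le_norm (𝕜 := ℂ) (T u) u
      have h3 : c * ‖u‖ ^ 2 ≤ (1 + M) * (‖T u‖ * ‖u‖) :=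
        h1.trans (mul_le_mul_of_nonneg_left h2 (by linarith))
      rw [div_mul_eq_mul_div, le_div_iff₀ hc]
      refine le_of_mul_le_mul_right ?_ hu'
      linarith
  have hanti : AntilipschitzWith ((1 + M) / c).toNNReal T :=
    T.antilipschitz_of_bound fun u => by rw [Real.coe_toNNReal _ hcM]; exact bound u
  have hclosed : IsClosed (T.range : Set E) := hanti.isClosed_range T.uniformContinuous
  have htop : T.range = ⊤ := by
    have := hclosed.completeSpace_coe
    rw [← Submodule.orthogonal_eq_bot_iff, Submodule.eq_bot_iff]
    intro w hw
    -- A vector orthogonal to the range is tested against its own image `T w`.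
    have h0 : B w w = 0 := (hTB w w).symm.trans (hw _ ⟨w, rfl⟩)
    have h1 := hn w
    rw [h0, norm_zero, mul_zero] at h1
    have h2 : ‖w‖ ^ 2 ≤ 0 := nonpos_of_mul_nonpos_right h1 hc
    exact norm_eq_zero.1 (pow_eq_zero_iff two_ne_zero |>.1 (le_antisymm h2 (by positivity)))
  set y := (InnerProductSpace.toDual ℂ E).symm F with hy
  obtain ⟨u, hu⟩ : y ∈ T.range := htop ▸ Submodule.mem_top
  have hu' : T u = y := hu
  have hyF : ∀ v, inner ℂ y v = F v := fun v => InnerProductSpace.toDual_symm_apply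
  refine ⟨u, fun v => by rw [← hTB, hu', hyF], fun u' h' => hanti.injective ?_, ?_⟩
  · rw [hu']
    exact ext_inner_right ℂ fun v => by rw [hTB, h', hyF]
  · have h1 := bound u
    rwa [hu', hy, LinearIsometryEquiv.norm_map] at h1

/-! ### Bounded forms and functionals on `L²` -/

theorem norm_sq_toLp {μ : Measure (ℝ × ℝ)} {F : ℝ × ℝ → ℂ} (hF : MemLp F 2 μ) :
    ‖hF.toLp F‖ ^ 2 = ∫ x, ‖F x‖ ^ 2 ∂μ := by
  apply Complex.ofReal_injective
  rw [← integral_complex_ofReal, Complex.ofReal_pow]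
  have h := inner_self_eq_norm_sq_to_K (𝕜 := ℂ) (hF.toLp F)
  refine h.symm.trans ?_
  rw [L2.inner_def]
  refine integral_congr_ae ?_
  filter_upwards [hF.coeFn_toLp] with x hx
  rw [hx, inner_self_eq_norm_sq_to_K]
  push_cast; rfl

/-- The form is the L² inner product of the first argument with `m` times the second. Each integral
in β has this shape with a bounded multiplier `m`. -/
theorem exists_mul_form {μ : Measure (ℝ × ℝ)} {m : ℝ × ℝ → ℂ} {A : ℝ}
    (hm : AEStronglyMeasurable m μ) (hA : ∀ᵐ x ∂μ, ‖m x‖ ≤ A) :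
    ∃ S : Lp ℂ 2 μ →L⋆[ℂ] Lp ℂ 2 μ →L[ℂ] ℂ, ∀ (F G : ℝ × ℝ → ℂ) (hF : MemLp F 2 μ)
      (hG : MemLp G 2 μ), S (hF.toLp F) (hG.toLp G) = ∫ x, m x * (conj (F x) * G x) ∂μ := by
  have mem : ∀ g : Lp ℂ 2 μ, MemLp (fun x => m x * g x) 2 μ := fun g => by
    refine (Lp.memLp g).of_le_mul (c := A) (hm.mul (Lp.memLp g).1) ?_
    filter_upwards [hA] with x hx
    rw [norm_mul]; gcongr
  let T : Lp ℂ 2 μ →ₗ[ℂ] Lp ℂ 2 μ :=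
    { toFun := fun g => (mem g).toLp _
      map_add' := fun g g' => by
        refine Lp.ext ?_
        filter_upwards [(mem (g + g')).coeFn_toLp, (mem g).coeFn_toLp, (mem g').coeFn_toLp,
          Lp.coeFn_add g g', Lp.coeFn_add ((mem g).toLp _) ((mem g').toLp _)] with x h1 h2 h3 h4 h5
        rw [h1, h5, Pi.add_apply, h2, h3, h4, Pi.add_apply, mul_add]
      map_smul' := fun c g => by
        refine Lp.ext ?_
        filter_upwards [(mem (c • g)).coeFn_toLp, (mem g).coeFn_toLp, Lp.coeFn_smul c g,
          Lp.coeFn_smul c ((mem g).toLp _)] with x h1 h2 h3 h4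
        rw [h1, RingHom.id_apply, h4, Pi.smul_apply, h2, h3, Pi.smul_apply, smul_eq_mul,
          smul_eq_mul]
        ring }
  let T' : Lp ℂ 2 μ →L[ℂ] Lp ℂ 2 μ := T.mkContinuous A fun g => by
    refine Lp.norm_le_mul_norm_of_ae_le_mul ?_
    filter_upwards [(mem g).coeFn_toLp, hA] with x h1 h2
    change ‖(mem g).toLp _ x‖ ≤ _
    rw [h1, norm_mul]; gcongr
  refine ⟨(innerSL ℂ).bilinearComp (ContinuousLinearMap.id ℂ _) T', fun F G hF hG => ?_⟩
  rw [ContinuousLinearMap.bilinearComp_apply, innerSL_apply_apply, L2.inner_def]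
  refine integral_congr_ae ?_
  filter_upwards [hF.coeFn_toLp, hG.coeFn_toLp, (mem (hG.toLp G)).coeFn_toLp] with x h1 h2 h3
  change inner ℂ (hF.toLp F x) ((mem (hG.toLp G)).toLp _ x) = _
  rw [h1, h3, h2, RCLike.inner_apply]
  ring

theorem exists_integral_mul_functional {μ : Measure (ℝ × ℝ)} {g : ℝ × ℝ → ℂ} (hg : MemLp g 2 μ) :
    ∃ T : Lp ℂ 2 μ →L[ℂ] ℂ, ∀ (F : ℝ × ℝ → ℂ) (hF : MemLp F 2 μ),
      T (hF.toLp F) = ∫ x, F x * g x ∂μ := by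
  refine ⟨innerSL ℂ (hg.star.toLp _), fun F hF => ?_⟩
  rw [innerSL_apply_apply, L2.inner_def]
  refine integral_congr_ae ?_
  filter_upwards [hF.coeFn_toLp, hg.star.coeFn_toLp] with x h1 h2
  rw [h1, h2, RCLike.inner_apply, Pi.star_apply, RCLike.star_def, RCLike.conj_conj]

/-- Weak gradients are tested on the full strip, but the Hilbert space sees one period only. For
periodic `F` the strip integral folds into a finite sum over vertical translates of `ψ`, each
continuous on L² of one period. -/
theorem exists_strip_functional (l r : ℝ) {H : ℝ} (hH : 0 < H) {ψ : ℝ × ℝ → ℂ}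
    (hψ : Continuous ψ) (hc : HasCompactSupport ψ) :
    ∃ T : Lp ℂ 2 (volume.restrict (rect l r H)) →L[ℂ] ℂ, ∀ (F : ℝ × ℝ → ℂ)
      (hF : MemLp F 2 (volume.restrict (rect l r H))), Function.Periodic F ((0, H) : ℝ × ℝ) →
        T (hF.toLp F) = ∫ x in Ioo l r ×ˢ univ, F x * ψ x := by
  obtain ⟨ρ, hρ⟩ := hc.isCompact.isBounded.subset_closedBall 0
  -- With `N * H > ρ`, the `2 * N` periods between `-N * H` and `N * H` cover the vertical extent of
  -- the support of `ψ`.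
  obtain ⟨N, hN⟩ := exists_nat_gt (ρ / H)
  rw [div_lt_iff₀ hH] at hN
  set v : ℕ → ℝ × ℝ := fun p => (0, -(N * H) + p * H) with hv
  have hψv : ∀ p, MemLp (fun x => ψ (x + v p)) 2 (volume.restrict (rect l r H)) := fun p =>
    (hψ.comp (continuous_id.add continuous_const)).memLp_of_hasCompactSupport
      (hc.comp_homeomorph (Homeomorph.addRight (v p)))
  choose T hT using fun p => exists_integral_mul_functional (hψv p)
  refine ⟨∑ p ∈ Finset.range (2 * N), T p, fun F hF hper => ?_⟩
  have hperv : ∀ p x, F (x + v p) = F x := fun p x => by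
    have h := hper.zsmul ((p : ℤ) - N) x
    rw [← h]
    congr 2
    ext <;> simp [hv]; ring
  have hsub : Ioo l r ×ˢ Ioo (-(N * H)) (-(N * H) + (2 * N : ℕ) * H) ⊆ Ioo l r ×ˢ univ :=
    prod_mono_right (subset_univ _)
  rw [setIntegral_eq_of_subset_of_forall_sdiff_eq_zero
    (measurableSet_Ioo.prod MeasurableSet.univ) hsub, restrict_prod_Ioo_eq_sum _ _ hH
      measurableSet_Ioo, integral_finsetSum_measure, sum_apply]
  · refine Finset.sum_congr rfl fun p _ => ?_
    rw [hT, (measurableEmbedding_addRight (v p)).integral_map]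
    simp only [hperv]
    rfl
  · intro p _
    rw [(measurableEmbedding_addRight (v p)).integrable_map_iff]
    refine (integrable_mul_of_memLp hF (hψv p)).congr (ae_of_all _ fun x => ?_)
    simp only [Function.comp, hperv]
  · intro x hx
    by_contra h0
    have h1 : x ∈ tsupport ψ := subset_tsupport ψ fun h => h0 (by rw [h, mul_zero])
    have h2 := hρ h1
    rw [mem_closedBall_zero_iff] at h2
    have h3 : |x.2| ≤ ρ := (norm_snd_le x).trans h2
    have h4 := abs_le.1 h3
    refine hx.2 ⟨hx.1.1, ?_, ?_⟩
    · linarith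
    · push_cast; linarith

theorem exists_hshift_map {l r H c s : ℝ} (hl : l ≤ c) (hr : c + s ≤ r) :
    ∃ T : Lp ℂ 2 (volume.restrict (rect l r H)) →L[ℂ] Lp ℂ 2 (volume.restrict (rect 0 s H)),
      ∀ F, T F =ᵐ[volume.restrict (rect 0 s H)] fun x => F (hshift c x) := by
  have hsub : rect c (c + s) H ⊆ rect l r H := prod_mono_left (Ioo_subset_Ioo hl hr)
  have hmp : MeasurePreserving (hshift c) (volume.restrict (rect 0 s H))
      ((volume.restrict (rect l r H)).restrict (rect c (c + s) H)) := by
    rw [Measure.restrict_restrict_of_subset hsub]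
    exact measurePreserving_hshift c s _
  refine ⟨(Lp.compMeasurePreservingₗᵢ ℂ (hshift c) hmp).toContinuousLinearMap.comp
    (LpToLpRestrictCLM (ℝ × ℝ) ℂ ℂ (volume.restrict (rect l r H)) 2 (rect c (c + s) H)),
    fun F => ?_⟩
  refine (Lp.coeFn_compMeasurePreserving _ hmp).trans ?_
  exact hmp.quasiMeasurePreserving.ae_eq_comp (LpToLpRestrictCLM_coeFn ℂ _ F)

/-! ### The span of admissible Bloch waves in `L²` -/

/-- By (A2) the wave vector determines the index within `I`, and there are only `L * K` wave
vectors. -/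
theorem IsAdmissible.finite {ε s c₀ C₀ : ℝ} {L K : ℕ} {b : ℝ × ℝ → ℝ}
    {Ψ : Fin L × Fin K → ℕ → H1Cell ε} {I : Set (BlochIndex L K)}
    (hI : IsAdmissible s b Ψ I c₀ C₀) : I.Finite :=
  Set.Finite.of_injOn (f := Prod.fst) (t := univ) (fun _ _ => mem_univ _)
    (fun x hx y hy h => by_contra fun hne => hI.wave_ne x hx y hy hne h) finite_univ

/-- Finitely many waves span a finite-dimensional subspace of L², and such subspaces are closed. -/
theorem exists_closed_blochSpan {ε : ℝ} (hε : 0 < ε) {L K : ℕ} (Ψ : Fin L × Fin K → ℕ → H1Cell ε)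
    {I : Set (BlochIndex L K)} (hI : I.Finite) :
    ∃ X : Submodule ℂ (Lp ℂ 2 (volume.restrict (box ε L K))),
      IsClosed (X : Set (Lp ℂ 2 (volume.restrict (box ε L K)))) ∧
      ∀ g, g ∈ X ↔ InSpan ε L K (blochSpan Ψ I) g := by
  let X : Submodule ℂ (Lp ℂ 2 (volume.restrict (box ε L K))) :=
    { carrier := {g | InSpan ε L K (blochSpan Ψ I) g}
      add_mem' := by
        rintro g g' ⟨w, hw, h⟩ ⟨w', hw', h'⟩
        exact ⟨w + w', add_mem hw hw', (Lp.coeFn_add g g').trans (h.add h')⟩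
      zero_mem' := ⟨0, zero_mem _, Lp.coeFn_zero _ _ _⟩
      smul_mem' := by
        rintro c g ⟨w, hw, h⟩
        exact ⟨c • w, Submodule.smul_mem _ c hw, (Lp.coeFn_smul c g).trans (h.const_smul c)⟩ }
  refine ⟨X, ?_, fun g => Iff.rfl⟩
  set Y : Submodule ℂ (Lp ℂ 2 (volume.restrict (box ε L K))) :=
    Submodule.span ℂ ((fun lam => (memLp_box_blochWave Ψ lam hε).toLp _) '' I)
  have hY : FiniteDimensional ℂ Y := FiniteDimensional.span_of_finite ℂ (hI.image _)
  have key : ∀ w ∈ blochSpan Ψ I, ∃ g ∈ Y, g =ᵐ[volume.restrict (box ε L K)] w := by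
    intro w hw
    induction hw using Submodule.span_induction with
    | mem w hw =>
      obtain ⟨lam, hlam, rfl⟩ := hw
      exact ⟨_, Submodule.subset_span ⟨lam, hlam, rfl⟩, MemLp.coeFn_toLp _⟩
    | zero => exact ⟨0, zero_mem _, Lp.coeFn_zero _ _ _⟩
    | add w w' _ _ h h' =>
      obtain ⟨g, hg, e⟩ := h
      obtain ⟨g', hg', e'⟩ := h'
      exact ⟨g + g', add_mem hg hg', (Lp.coeFn_add g g').trans (e.add e')⟩
    | smul c w _ h =>
      obtain ⟨g, hg, e⟩ := h
      exact ⟨c • g, Submodule.smul_mem _ c hg, (Lp.coeFn_smul c g).trans (e.const_smul c)⟩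
  -- The inclusion is enough, since subspaces of a finite-dimensional space are again
  -- finite-dimensional.
  have hle : X ≤ Y := by
    rintro g ⟨w, hw, h⟩
    obtain ⟨g', hg', e⟩ := key w hw
    have : g = g' := Lp.ext (h.trans e.symm)
    rwa [this]
  have : FiniteDimensional ℂ X := Submodule.finiteDimensional_of_le hle
  exact X.closed_of_finiteDimensional

theorem InSpan.congr {ε : ℝ} {L K : ℕ} {X : Submodule ℂ (ℝ × ℝ → ℂ)} {u u' : ℝ × ℝ → ℂ}
    (h : InSpan ε L K X u) (e : u' =ᵐ[volume.restrict (box ε L K)] u) : InSpan ε L K X u' :=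
  let ⟨w, hw, h'⟩ := h
  ⟨w, hw, e.trans h'⟩

/-! ### `H¹` as a closed subspace of `L² × L² × L²` -/

/-- The space of triples (function, two components of the gradient). -/
abbrev L2Triple (l r H : ℝ) : Type :=
  PiLp 2 (fun _ : Fin 3 => Lp ℂ 2 (volume.restrict (rect l r H)))

/-- An element of `H¹` as a triple of `L²` functions. -/
noncomputable def H1Strip.toL2 {l r H : ℝ} (u : H1Strip l r H) : L2Triple l r H :=
  WithLp.toLp 2 ![u.memLp_val.toLp _, u.memLp_d₁.toLp _, u.memLp_d₂.toLp _]

theorem H1Strip.norm_toL2_sq {l r H : ℝ} (u : H1Strip l r H) : ‖u.toL2‖ ^ 2 = u.h1NormSq := by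
  rw [PiLp.norm_sq_eq_of_L2, Fin.sum_univ_three]
  change ‖u.memLp_val.toLp _‖ ^ 2 + ‖u.memLp_d₁.toLp _‖ ^ 2 + ‖u.memLp_d₂.toLp _‖ ^ 2 = _
  rw [norm_sq_toLp, norm_sq_toLp, norm_sq_toLp]
  rfl

/-- The extension of a function by `H`-periodicity in the second variable. -/
noncomputable def periodize {H : ℝ} (hH : 0 < H) (F : ℝ × ℝ → ℂ) (x : ℝ × ℝ) : ℂ :=
  F (x.1, toIocMod hH 0 x.2)

theorem periodic_periodize {H : ℝ} (hH : 0 < H) (F : ℝ × ℝ → ℂ) :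
    Function.Periodic (periodize hH F) ((0, H) : ℝ × ℝ) := fun x => by
  simp [periodize]

theorem periodize_ae_eq {l r H : ℝ} (hH : 0 < H) (F : ℝ × ℝ → ℂ) :
    periodize hH F =ᵐ[volume.restrict (rect l r H)] F := by
  filter_upwards [ae_restrict_mem (measurableSet_rect l r H)] with x hx
  have : toIocMod hH 0 x.2 = x.2 :=
    (toIocMod_eq_self hH).2 ⟨hx.2.1, by rw [zero_add]; exact hx.2.2.le⟩
  simp only [periodize, this]

/-- For each test function the two weak gradient identities are kernels of continuous functionals,
so their intersection is closed. Conversely, an L² class knows only one period, and a function on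
the plane is recovered from it by `periodize`. -/
theorem exists_closed_weakGrad (l r : ℝ) {H : ℝ} (hH : 0 < H) :
    ∃ V : Submodule ℂ (L2Triple l r H),
      IsClosed (V : Set (L2Triple l r H)) ∧
      (∀ u : H1Strip l r H, u.toL2 ∈ V) ∧ ∀ g ∈ V, ∃ u : H1Strip l r H, u.toL2 = g := by
  choose S hS using fun φ : {φ // IsTest (Ioo l r ×ˢ univ) φ} =>
    exists_strip_functional l r hH φ.2.smooth.continuous φ.2.compact
  choose S₁ hS₁ using fun φ : {φ // IsTest (Ioo l r ×ˢ univ) φ} =>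
    exists_strip_functional l r hH (φ.2.continuous_fderiv (1, 0)) (φ.2.hasCompactSupport_fderiv _)
  choose S₂ hS₂ using fun φ : {φ // IsTest (Ioo l r ×ˢ univ) φ} =>
    exists_strip_functional l r hH (φ.2.continuous_fderiv (0, 1)) (φ.2.hasCompactSupport_fderiv _)
  let π : (i : Fin 3) → L2Triple l r H →L[ℂ] Lp ℂ 2 (volume.restrict (rect l r H)) :=
    fun i => PiLp.proj 2 (𝕜 := ℂ) (fun _ : Fin 3 => Lp ℂ 2 (volume.restrict (rect l r H))) i
  let Q₁ := fun φ => (S₁ φ).comp (π 0) + (S φ).comp (π 1)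
  let Q₂ := fun φ => (S₂ φ).comp (π 0) + (S φ).comp (π 2)
  have hV : ∀ g, g ∈ (⨅ φ, ((Q₁ φ).ker ⊓ (Q₂ φ).ker)) ↔ ∀ φ, S₁ φ (g 0) + S φ (g 1) = 0 ∧
      S₂ φ (g 0) + S φ (g 2) = 0 := by
    intro g
    rw [Submodule.mem_iInf]
    rfl
  refine ⟨⨅ φ, ((Q₁ φ).ker ⊓ (Q₂ φ).ker), ?_, fun u => ?_, fun g hg => ?_⟩
  · rw [Submodule.coe_iInf]
    exact isClosed_iInter fun φ => (Q₁ φ).isClosed_ker.inter (Q₂ φ).isClosed_ker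
  · rw [hV]
    intro φ
    have h := u.weakGrad φ φ.2
    change S₁ φ (u.memLp_val.toLp _) + S φ (u.memLp_d₁.toLp _) = 0 ∧
      S₂ φ (u.memLp_val.toLp _) + S φ (u.memLp_d₂.toLp _) = 0
    rw [hS₁ φ _ _ u.periodic_val, hS₂ φ _ _ u.periodic_val, hS φ _ _ u.periodic_d₁,
      hS φ _ _ u.periodic_d₂, h.1, h.2]
    simp
  · rw [hV] at hg
    have mem : ∀ i, MemLp (periodize hH (g i)) 2 (volume.restrict (rect l r H)) := fun i =>
      (Lp.memLp (g i)).ae_eq (periodize_ae_eq hH _).symm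
    have e : ∀ i, (mem i).toLp _ = g i := fun i =>
      Lp.ext ((mem i).coeFn_toLp.trans (periodize_ae_eq hH _))
    refine ⟨⟨periodize hH (g 0), periodize hH (g 1), periodize hH (g 2), periodic_periodize _ _,
      periodic_periodize _ _, periodic_periodize _ _, mem 0, mem 1, mem 2, fun φ hφ => ?_⟩, ?_⟩
    · have h := hg ⟨φ, hφ⟩
      rw [← e 0, ← e 1, ← e 2, hS₁ _ _ _ (periodic_periodize _ _),
        hS₂ _ _ _ (periodic_periodize _ _), hS _ _ _ (periodic_periodize _ _),
        hS _ _ _ (periodic_periodize _ _)] at h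
      exact ⟨eq_neg_of_add_eq_zero_left h.1, eq_neg_of_add_eq_zero_left h.2⟩
    · ext1 i
      fin_cases i
      · exact e 0
      · exact e 1
      · exact e 2

theorem ae_eq_comp_hshift {l r H c s : ℝ} (hl : l ≤ c) (hr : c + s ≤ r) {F G : ℝ × ℝ → ℂ}
    (h : F =ᵐ[volume.restrict (rect l r H)] G) :
    (fun x => F (hshift c x)) =ᵐ[volume.restrict (rect 0 s H)] fun x => G (hshift c x) :=
  (measurePreserving_hshift c s (Ioo 0 H)).quasiMeasurePreserving.ae_eq_comp
    (ae_mono (Measure.restrict_mono (prod_mono_left (Ioo_subset_Ioo hl hr)) le_rfl) h)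

/-- A closed subspace of `L²` triples that imposes the Bloch expansion in one radiation box. -/
theorem exists_closed_inSpan {ε : ℝ} (hε : 0 < ε) {L K : ℕ} {l r c : ℝ} (hl : l ≤ c)
    (hr : c + ε * L ≤ r) (Ψ : Fin L × Fin K → ℕ → H1Cell ε) {I : Set (BlochIndex L K)}
    (hI : I.Finite) :
    ∃ V : Submodule ℂ (L2Triple l r (ε * K)), IsClosed (V : Set (L2Triple l r (ε * K))) ∧
      ∀ u : H1Strip l r (ε * K), u.toL2 ∈ V ↔
        InSpan ε L K (blochSpan Ψ I) (fun x => u.val (hshift c x)) := by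
  obtain ⟨X, hX, hXmem⟩ := exists_closed_blochSpan hε Ψ hI
  obtain ⟨T, hT⟩ : ∃ T : Lp ℂ 2 (volume.restrict (rect l r (ε * K))) →L[ℂ]
      Lp ℂ 2 (volume.restrict (box ε L K)),
      ∀ F, T F =ᵐ[volume.restrict (box ε L K)] fun x => F (hshift c x) :=
    exists_hshift_map hl hr
  let Q := T.comp (PiLp.proj 2 (𝕜 := ℂ)
    (fun _ : Fin 3 => Lp ℂ 2 (volume.restrict (rect l r (ε * K)))) 0)
  refine ⟨X.comap Q.toLinearMap, hX.preimage Q.continuous, fun u => ?_⟩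
  change T (u.memLp_val.toLp _) ∈ X ↔ _
  have e : T (u.memLp_val.toLp _) =ᵐ[volume.restrict (box ε L K)]
      fun x => u.val (hshift c x) :=
    (hT _).trans (ae_eq_comp_hshift hl hr u.memLp_val.coeFn_toLp)
  rw [hXmem]
  exact ⟨fun h => h.congr e.symm, fun h => h.congr e⟩

/-! ### The solution space, the form β and the source on L² triples -/

section

variable {ε ω δ a₀ a₁ : ℝ} {K R L : ℕ} {a aP aM : ℝ × ℝ → ℝ}

/-- The triples of `L²` functions on the truncated domain. -/
abbrev TruncTriple (ε : ℝ) (K S : ℕ) : Type := L2Triple (-(ε * S)) (ε * S) (ε * K)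

theorem exists_closed_memV (hε : 0 < ε) (hK : 0 < K) (ΨP ΨM : Fin L × Fin K → ℕ → H1Cell ε)
    {IP IM : Set (BlochIndex L K)} (hIP : IP.Finite) (hIM : IM.Finite) :
    ∃ V : Submodule ℂ (TruncTriple ε K (R + L)), IsClosed (V : Set (TruncTriple ε K (R + L))) ∧
      (∀ u : H1Trunc ε K (R + L), MemV (blochSpan ΨP IP) (blochSpan ΨM IM) u → u.toL2 ∈ V) ∧
      ∀ g ∈ V, ∃ u : H1Trunc ε K (R + L), MemV (blochSpan ΨP IP) (blochSpan ΨM IM) u ∧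
        u.toL2 = g := by
  have hεK : 0 < ε * K := by positivity
  have h0 : 0 ≤ ε * R := by positivity
  have h1 : 0 ≤ ε * L := by positivity
  have h2 : ε * (R + L : ℕ) = ε * R + ε * L := by push_cast; ring
  obtain ⟨V, hV, hV1, hV2⟩ := exists_closed_weakGrad (-(ε * (R + L : ℕ))) (ε * (R + L : ℕ)) hεK
  obtain ⟨VP, hVP, hVP1⟩ := exists_closed_inSpan hε (l := -(ε * (R + L : ℕ)))
    (r := ε * (R + L : ℕ)) (c := ε * R) (by linarith) (by linarith) ΨP hIP
  obtain ⟨VM, hVM, hVM1⟩ := exists_closed_inSpan hε (l := -(ε * (R + L : ℕ)))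
    (r := ε * (R + L : ℕ)) (c := -(ε * (R + L : ℕ))) le_rfl (by linarith) ΨM hIM
  refine ⟨V ⊓ (VP ⊓ VM), hV.inter (hVP.inter hVM),
    fun u hu => ⟨hV1 u, (hVP1 u).2 hu.1, (hVM1 u).2 hu.2⟩, ?_⟩
  rintro g ⟨hg, hgP, hgM⟩
  obtain ⟨u, rfl⟩ := hV2 g hg
  exact ⟨u, ⟨(hVP1 u).1 hgP, (hVM1 u).1 hgM⟩, rfl⟩

theorem setIntegral_subset_eq_indicator_mul {D D' : Set (ℝ × ℝ)} (hD : MeasurableSet D)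
    (h : D ⊆ D') (m G : ℝ × ℝ → ℂ) :
    ∫ x in D, m x * G x = ∫ x in D', D.indicator m x * G x := by
  have : (fun x => D.indicator m x * G x) = D.indicator fun x => m x * G x := by
    funext x
    by_cases hx : x ∈ D <;> simp [hx]
  rw [this, setIntegral_indicator hD, inter_eq_right.2 h]

/-- The flux integrals live on smaller sets. Inserting indicator functions turns all terms into
bounded multiplier forms on one L² space, composed with the coordinate projections. -/
theorem exists_beta_form (hε : 0 < ε) (ha₀ : 0 < a₀) (hL : 0 < L)
    (hmed : IsMedium ε K R a₀ a₁ a aP aM) :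
    ∃ B : TruncTriple ε K (R + L) →L⋆[ℂ] TruncTriple ε K (R + L) →L[ℂ] ℂ,
      ∀ u v : H1Trunc ε K (R + L), B u.toL2 v.toL2 = beta ω δ a u v := by
  have hle : volume.restrict (trunc ε K (R + L)) ≤ volume.restrict (strip ε K) :=
    Measure.restrict_mono (trunc_subset_strip _ _ _) le_rfl
  have ham : AEStronglyMeasurable (fun x => (a x : ℂ)) (volume.restrict (trunc ε K (R + L))) :=
    Complex.continuous_ofReal.comp_aestronglyMeasurable (hmed.measurable.mono_measure hle)
  have habs : ∀ᵐ x ∂volume.restrict (trunc ε K (R + L)), ‖(a x : ℂ)‖ ≤ |a₁| := by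
    filter_upwards [ae_mono hle (hmed.ae_abs_le ha₀)] with x hx
    rwa [Complex.norm_real]
  have hcm : AEStronglyMeasurable (fun x : ℝ × ℝ => (cutoff ε R L x.1 : ℂ))
      (volume.restrict (trunc ε K (R + L))) :=
    (Complex.measurable_ofReal.comp (measurable_cutoff.comp measurable_fst)).aestronglyMeasurable
  have hc1 : ∀ x : ℝ × ℝ, ‖(cutoff ε R L x.1 : ℂ)‖ ≤ 1 := fun x => by
    rw [Complex.norm_real, Real.norm_eq_abs, abs_of_nonneg (cutoff_nonneg hε _)]
    exact cutoff_le_one hε hL _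
  have h1m : AEStronglyMeasurable (fun x : ℝ × ℝ => (a x : ℂ) * (cutoff ε R L x.1 : ℂ))
      (volume.restrict (trunc ε K (R + L))) := ham.mul hcm
  have h1b : ∀ᵐ x ∂volume.restrict (trunc ε K (R + L)),
      ‖(a x : ℂ) * (cutoff ε R L x.1 : ℂ)‖ ≤ |a₁| * 1 := by
    filter_upwards [habs] with x hx
    rw [norm_mul]
    exact mul_le_mul hx (hc1 x) (norm_nonneg _) (abs_nonneg _)
  have h2m : AEStronglyMeasurable (fun x : ℝ × ℝ =>
      (1 - Complex.I * δ * (trunc ε K R).indicator (fun _ => (1 : ℂ)) x) * (ω : ℂ) ^ 2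
        * (cutoff ε R L x.1 : ℂ)) (volume.restrict (trunc ε K (R + L))) :=
    ((aestronglyMeasurable_const.sub (aestronglyMeasurable_const.mul
      (aestronglyMeasurable_const.indicator (measurableSet_trunc ε K R)))).mul
        aestronglyMeasurable_const).mul hcm
  have h2b : ∀ᵐ x ∂volume.restrict (trunc ε K (R + L)),
      ‖(1 - Complex.I * δ * (trunc ε K R).indicator (fun _ => (1 : ℂ)) x) * (ω : ℂ) ^ 2
        * (cutoff ε R L x.1 : ℂ)‖ ≤ (1 + |δ| * 1) * ‖(ω : ℂ) ^ 2‖ * 1 := by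
    refine ae_of_all _ fun x => ?_
    have hi : ‖(trunc ε K R).indicator (fun _ => (1 : ℂ)) x‖ ≤ 1 :=
      (norm_indicator_le_norm_self _ _).trans (by simp)
    have hj : ‖1 - Complex.I * δ * (trunc ε K R).indicator (fun _ => (1 : ℂ)) x‖ ≤
        1 + |δ| * 1 := by
      refine (norm_sub_le _ _).trans ?_
      rw [norm_one, norm_mul, norm_mul, Complex.norm_I, one_mul, Complex.norm_real,
        Real.norm_eq_abs]
      gcongr
    rw [norm_mul, norm_mul]
    exact mul_le_mul (mul_le_mul_of_nonneg_right hj (norm_nonneg _)) (hc1 x) (norm_nonneg _)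
      (by positivity)
  have h3m := ham.indicator (measurableSet_rect (ε * R) (ε * (R + L : ℕ)) (ε * K))
  have h4m := ham.indicator (measurableSet_rect (-(ε * (R + L : ℕ))) (-(ε * R)) (ε * K))
  have h3b : ∀ D : Set (ℝ × ℝ), ∀ᵐ x ∂volume.restrict (trunc ε K (R + L)),
      ‖D.indicator (fun x => (a x : ℂ)) x‖ ≤ |a₁| := fun D => by
    filter_upwards [habs] with x hx
    exact (norm_indicator_le_norm_self _ _).trans hx
  obtain ⟨S₁, hS₁⟩ := exists_mul_form h1m h1b
  obtain ⟨S₂, hS₂⟩ := exists_mul_form h2m h2b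
  obtain ⟨S₃, hS₃⟩ := exists_mul_form h3m (h3b _)
  obtain ⟨S₄, hS₄⟩ := exists_mul_form h4m (h3b _)
  let π : (i : Fin 3) → TruncTriple ε K (R + L) →L[ℂ]
      Lp ℂ 2 (volume.restrict (trunc ε K (R + L))) := fun i => PiLp.proj 2 (𝕜 := ℂ)
    (fun _ : Fin 3 => Lp ℂ 2 (volume.restrict (trunc ε K (R + L)))) i
  refine ⟨S₁.bilinearComp (π 1) (π 1) + S₁.bilinearComp (π 2) (π 2) - S₂.bilinearComp (π 0) (π 0)
    - (1 / (ε * L : ℂ)) • S₃.bilinearComp (π 1) (π 0)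
    + (1 / (ε * L : ℂ)) • S₄.bilinearComp (π 1) (π 0), fun u v => ?_⟩
  have mem : ∀ w : H1Trunc ε K (R + L), MemLp w.val 2 (volume.restrict (trunc ε K (R + L))) ∧
      MemLp w.d₁ 2 (volume.restrict (trunc ε K (R + L))) ∧
      MemLp w.d₂ 2 (volume.restrict (trunc ε K (R + L))) :=
    fun w => ⟨w.memLp_val, w.memLp_d₁, w.memLp_d₂⟩
  obtain ⟨u₀, u₁, u₂⟩ := mem u
  obtain ⟨v₀, v₁, v₂⟩ := mem v
  change S₁ (u₁.toLp _) (v₁.toLp _) + S₁ (u₂.toLp _) (v₂.toLp _)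
    - S₂ (u₀.toLp _) (v₀.toLp _) - (1 / (ε * L : ℂ)) * S₃ (u₁.toLp _) (v₀.toLp _)
    + (1 / (ε * L : ℂ)) * S₄ (u₁.toLp _) (v₀.toLp _) = _
  have int1 : ∀ {F G : ℝ × ℝ → ℂ}, MemLp F 2 (volume.restrict (trunc ε K (R + L))) →
      MemLp G 2 (volume.restrict (trunc ε K (R + L))) →
      Integrable (fun x => (a x : ℂ) * (cutoff ε R L x.1 : ℂ) * (conj (F x) * G x))
        (volume.restrict (trunc ε K (R + L))) := fun hF hG =>
    (integrable_mul_of_memLp hF.star hG).bdd_mul h1m h1b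
  rw [hS₁, hS₁, hS₂, hS₃, hS₄, beta]
  congr 1
  · congr 1
    · congr 1
      · refine (integral_add (int1 u₁ v₁) (int1 u₂ v₂)).symm.trans ?_
        congr 1; funext x
        ring
      · refine integral_congr_ae (ae_of_all _ fun x => ?_)
        simp only
        ring
    · congr 1
      refine (setIntegral_subset_eq_indicator_mul (measurableSet_rect _ _ _)
        (boxRight_subset hε K R L) _ _).symm.trans ?_
      simp only [mul_assoc]
      rfl
  · congr 1
    refine (setIntegral_subset_eq_indicator_mul (measurableSet_rect _ _ _)
      (boxLeft_subset hε K R L) _ _).symm.trans ?_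
    simp only [mul_assoc]
    rfl

/-- The functional is the inner product with `f` cut off to Ω_R, applied to the value component;
Cauchy–Schwarz gives the norm bound that enters the final estimate. -/
theorem exists_source_functional (hε : 0 < ε) {f : ℝ × ℝ → ℂ}
    (hf : MemLp f 2 (volume.restrict (strip ε K))) :
    ∃ F : TruncTriple ε K (R + L) →L[ℂ] ℂ, ‖F‖ ≤ Real.sqrt (l2NormSq (trunc ε K R) f) ∧
      ∀ v : H1Trunc ε K (R + L), F v.toL2 = ∫ x in trunc ε K R, conj (f x) * v.val x := by
  have hm := measurableSet_trunc ε K R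
  have hsub := trunc_subset hε K R L
  have hg : MemLp ((trunc ε K R).indicator f) 2 (volume.restrict (trunc ε K (R + L))) :=
    (hf.mono_measure (Measure.restrict_mono (trunc_subset_strip _ _ _) le_rfl)).indicator hm
  let π₀ : TruncTriple ε K (R + L) →L[ℂ] Lp ℂ 2 (volume.restrict (trunc ε K (R + L))) :=
    PiLp.proj 2 (𝕜 := ℂ) (fun _ : Fin 3 => Lp ℂ 2 (volume.restrict (trunc ε K (R + L)))) 0
  refine ⟨(innerSL ℂ (hg.toLp _)).comp π₀, ?_, fun v => ?_⟩
  · have hn : ‖hg.toLp _‖ = Real.sqrt (l2NormSq (trunc ε K R) f) := by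
      rw [← Real.sqrt_sq (norm_nonneg (hg.toLp _)), norm_sq_toLp]
      congr 1
      have : (fun x => ‖(trunc ε K R).indicator f x‖ ^ 2) =
          (trunc ε K R).indicator fun x => ‖f x‖ ^ 2 := by
        funext x
        by_cases hx : x ∈ trunc ε K R <;> simp [hx]
      rw [this, setIntegral_indicator hm, inter_eq_right.2 hsub]
      rfl
    rw [← hn]
    refine ContinuousLinearMap.opNorm_le_bound _ (norm_nonneg _) fun v => ?_
    refine (norm_inner_le_norm (𝕜 := ℂ) (hg.toLp _) (π₀ v)).trans ?_
    exact mul_le_mul_of_nonneg_left (PiLp.norm_apply_le v 0) (norm_nonneg _)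
  · have hv : MemLp v.val 2 (volume.restrict (trunc ε K (R + L))) := v.memLp_val
    change inner ℂ (hg.toLp _) (hv.toLp _) = _
    rw [L2.inner_def]
    calc _ = ∫ x in trunc ε K (R + L),
          (trunc ε K R).indicator (fun x => conj (f x)) x * v.val x := by
          refine integral_congr_ae ?_
          filter_upwards [hg.coeFn_toLp, hv.coeFn_toLp] with x h1 h2
          rw [h1, h2, RCLike.inner_apply]
          by_cases hx : x ∈ trunc ε K R <;> simp [hx, mul_comm]
      _ = _ := (setIntegral_subset_eq_indicator_mul hm hsub _ _).symm

end

end Waveguide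

/-! ### Unique solvability and the a priori bound -/

open Waveguide
theorem mainTheorem1
    (ε ω δ a₀ a₁ c₀ C₀ : ℝ) (K R L : ℕ)
    (hε : 0 < ε) (hω : 0 < ω) (hδ : 0 < δ) (ha₀ : 0 < a₀) (hc₀ : 0 < c₀) (hC₀ : 0 < C₀)
    (hK : 0 < K) (hR : 0 < R) (hL : 0 < L) :
    ∃ C : ℝ, 0 < C ∧
      ∀ (a aP aM : ℝ × ℝ → ℝ) (ΨP ΨM : Fin L × Fin K → ℕ → H1Cell ε)
        (IP IM : Set (BlochIndex L K)) (f : ℝ × ℝ → ℂ),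
        IsMedium ε K R a₀ a₁ a aP aM →
        (∀ k, IsBlochFamily ε aP (waveVector k) (ΨP k)) →
        (∀ k, IsBlochFamily ε aM (waveVector k) (ΨM k)) →
        IsAdmissible 1 aP ΨP IP c₀ C₀ →
        IsAdmissible (-1) aM ΨM IM c₀ C₀ →
        MemLp f 2 (volume.restrict (strip ε K)) →
        (∀ᵐ x ∂volume.restrict (strip ε K), x ∉ trunc ε K R → f x = 0) →
        ∃ u : H1Trunc ε K (R + L),
          IsSolution ω δ a (blochSpan ΨP IP) (blochSpan ΨM IM) f u ∧
          (∀ u' : H1Trunc ε K (R + L),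
            IsSolution ω δ a (blochSpan ΨP IP) (blochSpan ΨM IM) f u' →
            u'.val =ᵐ[volume.restrict (trunc ε K (R + L))] u.val) ∧
          Real.sqrt u.h1NormSq ≤ C * Real.sqrt (l2NormSq (trunc ε K R) f) := by
  have hL' : (0 : ℝ) < L := by exact_mod_cast hL
  -- γ is the smaller of the L² control from absorption and that from the flux. `M` is then chosen
  -- so that the condition of `beta_coercive` holds with equality. Both use only the admitted
  -- parameters.
  set γ := min (δ * ω ^ 2) (1 / (ε * L) * c₀) with hγ
  have hγ0 : 0 < γ := lt_min (by positivity) (by positivity)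
  set M := (ω ^ 2 + 1 / (ε * L) * (|a₁| / 2 * C₀) + a₀ * (C₀ + 1)) / γ with hMdef
  have hM : 0 ≤ M := by positivity
  have hMγ : ω ^ 2 + 1 / (ε * L) * (|a₁| / 2 * C₀) + a₀ * (C₀ + 1) ≤ M * γ :=
    (div_mul_cancel₀ _ hγ0.ne').ge
  -- This is the Lax–Milgram constant for coercivity constant `a₀`; it is fixed before the medium,
  -- the waves and the source are introduced.
  refine ⟨(1 + M) / a₀, by positivity, fun a aP aM ΨP ΨM IP IM f hmed hΨP hΨM hIP hIM hf _ => ?_⟩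
  obtain ⟨V, hVc, hV1, hV2⟩ := exists_closed_memV (R := R) hε hK ΨP ΨM hIP.finite hIM.finite
  obtain ⟨B, hB⟩ := exists_beta_form (ω := ω) (δ := δ) hε ha₀ hL hmed
  obtain ⟨F, hFn, hF⟩ := exists_source_functional (R := R) (L := L) hε hf
  have : CompleteSpace V := hVc.completeSpace_coe
  have hcoer : ∀ g : V, a₀ * ‖g‖ ^ 2 ≤ (B.bilinearComp V.subtypeL V.subtypeL g g).re +
      M * (B.bilinearComp V.subtypeL V.subtypeL g g).im := by
    rintro ⟨g, hg⟩
    obtain ⟨u, hu, rfl⟩ := hV2 g hg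
    change a₀ * ‖u.toL2‖ ^ 2 ≤ (B u.toL2 u.toL2).re + M * (B u.toL2 u.toL2).im
    rw [hB, u.norm_toL2_sq]
    exact beta_coercive hε ha₀ hC₀ hK hR hL hmed hΨP hΨM hIP hIM hM (min_le_left _ _)
      (min_le_right _ _) hMγ u hu
  obtain ⟨⟨g, hg⟩, hsol, huniq, hbound⟩ :=
    lax_milgram (B.bilinearComp V.subtypeL V.subtypeL) ha₀ hM hcoer (F.comp V.subtypeL)
  obtain ⟨u, hu, rfl⟩ := hV2 g hg
  refine ⟨u, ⟨hu, fun v hv => ?_⟩, fun u' hu' => ?_, ?_⟩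
  · rw [← hB, ← hF]
    exact hsol ⟨v.toL2, hV1 v hv⟩
  -- Any solution yields an element of `V` solving the abstract equation, so the triples agree.
  -- Their first components then agree almost everywhere.
  · have h : u'.toL2 = u.toL2 := by
      refine congrArg Subtype.val (huniq ⟨u'.toL2, hV1 u' hu'.1⟩ ?_)
      rintro ⟨g', hg'⟩
      obtain ⟨v, hv, rfl⟩ := hV2 g' hg'
      change B u'.toL2 v.toL2 = F v.toL2
      rw [hB, hF]
      exact hu'.2 v hv
    have h0 : u'.memLp_val.toLp _ = u.memLp_val.toLp _ := congrArg (fun g => g 0) h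
    exact (MemLp.toLp_eq_toLp_iff _ _).1 h0
  · rw [← u.norm_toL2_sq, Real.sqrt_sq (norm_nonneg _)]
    refine hbound.trans (mul_le_mul_of_nonneg_left (le_trans ?_ hFn) (by positivity))
    refine (F.opNorm_comp_le _).trans (mul_le_of_le_one_right (norm_nonneg _) ?_)
    exact V.norm_subtypeL_le
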